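/- Let $(\overline M^{n+1},\langle\,,\rangle)$ be a smooth Riemannian manifold, $\psi:M^n\to\overline M^{n+1}$ a smooth isometric immersion of an $n$-dimensional Riemannian manifold $M$, $N$ a smooth unit normal field along $\psi$, and $f:\overline M\to\mathbb R$ a smooth function. Let $\nabla,\overline\nabla$ be the Levi-Civita connections of $M,\overline M$, let $\overline R(X,Y)Z=\overline\nabla_Y\overline\nabla_XZ-\overline\nabla_X\overline\nabla_YZ+\overline\nabla_{[X,Y]}Z$ be the curvature tensor of $\overline M$, let $^\top$ be the orthogonal projection onto $TM$, and let $A X=-(\overline\nabla_XN)^\top$ be the shape operator, with eigenvalues $\lambda_1,\dots,\lambda_n$. Put $\mu_1=\langle\overline\nabla f,N\rangle$, a function on $M$, and write $f$ also for $f\circ\psi$ and $\nabla$ also for the gradient on $M$. Define functions $\sigma_k^\infty=\sigma_k^\infty(\mu_1,A)$ on $M$ by $\sigma_0^\infty=1$ and $$k\,\sigma_k^\infty=\sigma_{k-1}^\infty\Big(\mu_1+\sum_{j=1}^n\lambda_j\Big)+\sum_{i=1}^{k-1}(-1)^i\sigma_{k-1-i}^\infty\sum_{j=1}^n\lambda_j^{\,i+1}\qquad(k\ge1),$$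 and fields of endomorphisms of $TM$ by $T_0^\infty=I$, $T_k^\infty=\sigma_k^\infty I-A\,T_{k-1}^\infty$ for $k\ge1$. For a field $T$ of endomorphisms let $\operatorname{div}T=\sum_{i=1}^n(\nabla_{e_i}T)(e_i)$ for an orthonormal basis $e_1,\dots,e_n$ of the tangent space of $M$, and $\operatorname{div}_fT=e^{f}\operatorname{div}(e^{-f}T)$. Then at every point of $M$ and for every orthonormal basis $e_1,\dots,e_n$ of the tangent space there, $$\operatorname{div}_fT_0^\infty=-\nabla f,$$ and for every $k\ge1$ $$\operatorname{div}_fT_k^\infty=-\sigma_k^\infty\nabla f+\sigma_{k-1}^\infty\nabla\mu_1-A\,\operatorname{div}_fT_{k-1}^\infty-\sum_{i=1}^n\big(\overline R(N,T_{k-1}^\infty e_i)e_i\big)^\top .$$ -/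

import Mathlib

open Set Filter Topology Manifold Bundle
open scoped ContDiff

set_option maxSynthPendingDepth 3

noncomputable section

/-! ### Weighted symmetric functions and weighted Newton transformations -/

/-- The weighted elementary symmetric functions `σ_k^∞(μ₀, μ)` of a real number `μ₀` and a finite
family `μ = (μ_1, …, μ_n)` of real numbers (a multiset), defined by `σ_0^∞ = 1` and
`k σ_k^∞ = σ_{k-1}^∞ ∑_{j=0}^n μ_j + ∑_{i=1}^{k-1} ∑_{j=1}^n (-1)^i σ_{k-1-i}^∞ μ_j^{i+1}`.
In the second clause `k` is `m + 1` and the summation index `i` is shifted by one. -/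
def weightedSigma (μ₀ : ℝ) (μ : Multiset ℝ) : ℕ → ℝ
  | 0 => 1
  | m + 1 =>
      (weightedSigma μ₀ μ m * (μ₀ + μ.sum) +
        ∑ i : Fin m, (-1) ^ (i.val + 1) * weightedSigma μ₀ μ (m - 1 - i.val) *
          (μ.map fun t => t ^ (i.val + 2)).sum) / ((m : ℝ) + 1)
  decreasing_by all_goals omega

/-- The real eigenvalues of an endomorphism, counted with algebraic multiplicity. For a
self-adjoint endomorphism of an `n`-dimensional space these are its `n` eigenvalues. -/
def eigenvalueMultiset {V : Type*} [AddCommGroup V] [Module ℝ V] [FiniteDimensional ℝ V]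
    (A : V →ₗ[ℝ] V) : Multiset ℝ :=
  A.charpoly.roots

/-- `σ_k^∞(μ₀, A)`: the weighted elementary symmetric function of the eigenvalues of `A`. -/
def weightedSigmaOp {V : Type*} [AddCommGroup V] [Module ℝ V] [FiniteDimensional ℝ V]
    (μ₀ : ℝ) (A : V →ₗ[ℝ] V) (k : ℕ) : ℝ :=
  weightedSigma μ₀ (eigenvalueMultiset A) k

/-- The weighted Newton transformations: `T_0^∞ = I`, `T_k^∞ = σ_k^∞ I - A T_{k-1}^∞`. -/
def weightedNewton {V : Type*} [AddCommGroup V] [Module ℝ V] [FiniteDimensional ℝ V]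
    (μ₀ : ℝ) (A : V →ₗ[ℝ] V) : ℕ → (V →ₗ[ℝ] V)
  | 0 => LinearMap.id
  | k + 1 => weightedSigmaOp μ₀ A (k + 1) • LinearMap.id - A ∘ₗ weightedNewton μ₀ A k

/-! ### Coordinate expressions of a metric: Christoffel symbols and curvature -/

section Coordinates

variable {E : Type*} [NormedAddCommGroup E] [NormedSpace ℝ E]

/-- The linear form `z ↦ ½ (D_u h(v, z) + D_v h(u, z) - D_z h(u, v))` at `y`, for a metric `h`
on an open subset of `E` (the Christoffel symbols of the first kind). -/
def christoffelForm (h : E → E →L[ℝ] E →L[ℝ] ℝ) (y u v : E) : E →L[ℝ] ℝ :=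
  (1 / 2 : ℝ) • (fderiv ℝ h y u v + fderiv ℝ h y v u - ((fderiv ℝ h y).flip u).flip v)

/-- The Christoffel symbols `Γ_y(u, v)` of a metric `h` on an open subset of `E`: the vector with
`h_y(Γ_y(u, v), z) = ½ (D_u h(v, z) + D_v h(u, z) - D_z h(u, v))` for all `z`. -/
def christoffel (h : E → E →L[ℝ] E →L[ℝ] ℝ) (y : E) : E →ₗ[ℝ] E →ₗ[ℝ] E :=
  LinearMap.mk₂ ℝ (fun u v => (h y).inverse (christoffelForm h y u v))
    (fun u u' v => by
      rw [← map_add]; congr 1; ext z; simp [christoffelForm]; ring)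
    (fun c u v => by
      rw [← map_smul]; congr 1; ext z; simp [christoffelForm]; ring)
    (fun u v v' => by
      rw [← map_add]; congr 1; ext z; simp [christoffelForm]; ring)
    (fun c u v => by
      rw [← map_smul]; congr 1; ext z; simp [christoffelForm]; ring)

theorem christoffel_spec (h : E → E →L[ℝ] E →L[ℝ] ℝ) (y : E) (hy : (h y).IsInvertible)
    (u v z : E) :
    h y (christoffel h y u v) z =
      1 / 2 * (fderiv ℝ h y u v z + fderiv ℝ h y v u z - fderiv ℝ h y z u v) := by
  have key : h y (christoffel h y u v) = christoffelForm h y u v := by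
    obtain ⟨L, hL⟩ := hy
    simp [christoffel, ← hL, ContinuousLinearMap.inverse_equiv]
  rw [key]
  simp [christoffelForm]

/-- The curvature `R(u, v)w = ∇_v ∇_u w - ∇_u ∇_v w` of a metric `h` on an open subset of `E`,
for constant vector fields `u`, `v`, `w`. -/
def coordCurvature (h : E → E →L[ℝ] E →L[ℝ] ℝ) (y u v w : E) : E :=
  fderiv ℝ (fun y' => christoffel h y' u w) y v - fderiv ℝ (fun y' => christoffel h y' v w) y u
    + christoffel h y v (christoffel h y u w) - christoffel h y u (christoffel h y v w)

end Coordinates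

/-! ### Riemannian manifolds -/

section Manifold

/-- Smooth Riemannian metrics on a `d`-dimensional manifold `M`. -/
abbrev RiemMetric (d : ℕ) (M : Type*) [TopologicalSpace M]
    [ChartedSpace (EuclideanSpace ℝ (Fin d)) M] [IsManifold (𝓡 d) ∞ M] :=
  ContMDiffRiemannianMetric (𝓡 d) ∞ (EuclideanSpace ℝ (Fin d))
    (fun x : M => TangentSpace (𝓡 d) x)

variable {d : ℕ} {M : Type*} [TopologicalSpace M] [ChartedSpace (EuclideanSpace ℝ (Fin d)) M]

instance instFiniteDimensionalTangentSpaceEuclidean (x : M) :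
    FiniteDimensional ℝ (TangentSpace (𝓡 d) x) :=
  inferInstanceAs (FiniteDimensional ℝ (EuclideanSpace ℝ (Fin d)))

/-- The differential at `q` of the preferred chart around `x₀`. -/
def chartDeriv (x₀ q : M) : TangentSpace (𝓡 d) q →L[ℝ] EuclideanSpace ℝ (Fin d) :=
  mfderiv (𝓡 d) 𝓘(ℝ, EuclideanSpace ℝ (Fin d)) (extChartAt (𝓡 d) x₀) q

/-- The extension of `w ∈ T_x M` to the vector field near `x` that has constant coordinates in the
preferred chart around `x`. -/
def constExtension (x : M) (w : TangentSpace (𝓡 d) x) (q : M) : TangentSpace (𝓡 d) q :=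
  (chartDeriv x q).inverse (chartDeriv x x w)

variable [IsManifold (𝓡 d) ∞ M]

/-- The metric `g` read in the preferred chart around `x₀`. -/
def coordMetric (g : RiemMetric d M) (x₀ : M) (y : EuclideanSpace ℝ (Fin d)) :
    EuclideanSpace ℝ (Fin d) →L[ℝ] EuclideanSpace ℝ (Fin d) →L[ℝ] ℝ :=
  let q : M := (extChartAt (𝓡 d) x₀).symm y
  ContinuousLinearMap.precomp ℝ (chartDeriv x₀ q).inverse ∘L
    g.inner q ∘L (chartDeriv x₀ q).inverse

/-- The Riemann curvature tensor with the sign convention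
`R(X, Y)Z = ∇_Y ∇_X Z - ∇_X ∇_Y Z + ∇_{[X, Y]} Z`. -/
def curvature (g : RiemMetric d M) (x : M) (u v w : TangentSpace (𝓡 d) x) :
    TangentSpace (𝓡 d) x :=
  (chartDeriv x x).inverse
    (coordCurvature (coordMetric g x) (extChartAt (𝓡 d) x x)
      (chartDeriv x x u) (chartDeriv x x v) (chartDeriv x x w))

/-- The gradient of `φ`: `g_x(∇φ, v) = dφ_x(v)`. -/
def riemGradient (g : RiemMetric d M) (φ : M → ℝ) (x : M) : TangentSpace (𝓡 d) x :=
  (g.inner x).inverse (mfderiv (𝓡 d) 𝓘(ℝ, ℝ) φ x)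

/-- The vectors `e_1, …, e_d` form an orthonormal basis of `T_x M`. -/
def IsOrthonormalBasis (g : RiemMetric d M) (x : M) (e : Fin d → TangentSpace (𝓡 d) x) : Prop :=
  ∀ i j, g.inner x (e i) (e j) = if i = j then 1 else 0

variable {n : ℕ} {S : Type*} [TopologicalSpace S] [ChartedSpace (EuclideanSpace ℝ (Fin n)) S]

/-- A vector field `Y` along `ψ : S → M`, read near `x` in the preferred chart around `ψ x`. -/
def coordFieldAlong (ψ : S → M) (Y : ∀ q : S, TangentSpace (𝓡 d) (ψ q)) (x q : S) :
    EuclideanSpace ℝ (Fin d) :=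
  chartDeriv (ψ x) (ψ q) (Y q)

/-- The Levi-Civita covariant derivative `v ↦ ∇_v Y` at `x` of a vector field `Y` along a map
`ψ : S → M`: in the preferred chart around `ψ x`, it is `dY(v) + Γ(dψ v, Y)`.
For `ψ = id` this is the Levi-Civita connection of `g`. -/
def covDerivAlong (g : RiemMetric d M) (ψ : S → M) (Y : ∀ q : S, TangentSpace (𝓡 d) (ψ q))
    (x : S) : TangentSpace (𝓡 n) x →ₗ[ℝ] TangentSpace (𝓡 d) (ψ x) :=
  let Γ := christoffel (coordMetric g (ψ x)) (extChartAt (𝓡 d) (ψ x) (ψ x))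
  let dY : TangentSpace (𝓡 n) x →L[ℝ] EuclideanSpace ℝ (Fin d) :=
    mfderiv (𝓡 n) 𝓘(ℝ, EuclideanSpace ℝ (Fin d)) (coordFieldAlong ψ Y x) x
  (chartDeriv (ψ x) (ψ x)).inverse.toLinearMap ∘ₗ
    (dY.toLinearMap + Γ.flip (coordFieldAlong ψ Y x x) ∘ₗ
      (chartDeriv (ψ x) (ψ x) ∘L mfderiv (𝓡 n) (𝓡 d) ψ x).toLinearMap)

/-- The Levi-Civita connection: `covDeriv g Y x v = ∇_v Y`. -/
def covDeriv (g : RiemMetric d M) (Y : ∀ q : M, TangentSpace (𝓡 d) q) (x : M) :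
    TangentSpace (𝓡 d) x →ₗ[ℝ] TangentSpace (𝓡 d) x :=
  covDerivAlong g (fun q : M => q) Y x

/-- The covariant derivative of a field of endomorphisms,
`(∇_v T) w = ∇_v (T W) - T (∇_v W)`, where `W` is a vector field extending `w`. -/
def covDerivEnd (g : RiemMetric d M)
    (T : ∀ q : M, TangentSpace (𝓡 d) q →ₗ[ℝ] TangentSpace (𝓡 d) q)
    (x : M) (v w : TangentSpace (𝓡 d) x) : TangentSpace (𝓡 d) x :=
  covDeriv g (fun q => T q (constExtension x w q)) x v - T x (covDeriv g (constExtension x w) x v)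

/-- The divergence `∑ i, (∇_{e_i} T) e_i` of a field of endomorphisms, computed in an orthonormal
basis `e` of `T_x M`. -/
def divergence (g : RiemMetric d M)
    (T : ∀ q : M, TangentSpace (𝓡 d) q →ₗ[ℝ] TangentSpace (𝓡 d) q)
    (x : M) (e : Fin d → TangentSpace (𝓡 d) x) : TangentSpace (𝓡 d) x :=
  ∑ i, covDerivEnd g T x (e i) (e i)

/-- The weighted divergence `div_φ T = e^φ div (e^{-φ} T)`. -/
def weightedDivergence (g : RiemMetric d M) (φ : M → ℝ)
    (T : ∀ q : M, TangentSpace (𝓡 d) q →ₗ[ℝ] TangentSpace (𝓡 d) q)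
    (x : M) (e : Fin d → TangentSpace (𝓡 d) x) : TangentSpace (𝓡 d) x :=
  Real.exp (φ x) • divergence g (fun q => Real.exp (-φ q) • T q) x e

/-! ### Hypersurfaces -/

variable [IsManifold (𝓡 n) ∞ S]

/-- `ψ` is a smooth isometric immersion of `(S, g)` into `(M, gM)`. -/
def IsIsometricImmersion (g : RiemMetric n S) (gM : RiemMetric d M) (ψ : S → M) : Prop :=
  ContMDiff (𝓡 n) (𝓡 d) ∞ ψ ∧
    ∀ (x : S) (v w : TangentSpace (𝓡 n) x),
      gM.inner (ψ x) (mfderiv (𝓡 n) (𝓡 d) ψ x v) (mfderiv (𝓡 n) (𝓡 d) ψ x w) = g.inner x v w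

/-- `N` is a smooth unit normal vector field along `ψ`. -/
def IsUnitNormalField (gM : RiemMetric d M) (ψ : S → M)
    (N : ∀ q : S, TangentSpace (𝓡 d) (ψ q)) : Prop :=
  ContMDiff (𝓡 n) (𝓡 d).tangent ∞
      (fun q => (⟨ψ q, N q⟩ : TangentBundle (𝓡 d) M)) ∧
    ∀ x : S, gM.inner (ψ x) (N x) (N x) = 1 ∧
      ∀ v : TangentSpace (𝓡 n) x, gM.inner (ψ x) (N x) (mfderiv (𝓡 n) (𝓡 d) ψ x v) = 0

/-- The tangential part `w^⊤` of `w ∈ T_{ψ x} M`, as a vector of `T_x S`: the vector with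
`g_x(w^⊤, v) = gM(w, dψ v)` for all `v ∈ T_x S`. -/
def tangentialPart (g : RiemMetric n S) (gM : RiemMetric d M) (ψ : S → M) (x : S) :
    TangentSpace (𝓡 d) (ψ x) →ₗ[ℝ] TangentSpace (𝓡 n) x where
  toFun w := (g.inner x).inverse (gM.inner (ψ x) w ∘L mfderiv (𝓡 n) (𝓡 d) ψ x)
  map_add' w w' := by simp [ContinuousLinearMap.add_comp]
  map_smul' c w := by simp [ContinuousLinearMap.smul_comp]

/-- The shape operator `A X = -(∇_X N)^⊤` of the hypersurface with respect to `N`. -/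
def shapeOperator (g : RiemMetric n S) (gM : RiemMetric d M) (ψ : S → M)
    (N : ∀ q : S, TangentSpace (𝓡 d) (ψ q)) (x : S) :
    TangentSpace (𝓡 n) x →ₗ[ℝ] TangentSpace (𝓡 n) x :=
  -(tangentialPart g gM ψ x ∘ₗ covDerivAlong gM ψ N x)

/-- The function `⟨∇f, N⟩` on `S`, where `∇f` is the gradient of `f` on the ambient manifold. -/
def normalDerivative (gM : RiemMetric d M) (ψ : S → M)
    (N : ∀ q : S, TangentSpace (𝓡 d) (ψ q)) (f : M → ℝ) (x : S) : ℝ :=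
  gM.inner (ψ x) (riemGradient gM f (ψ x)) (N x)

end Manifold

end

/-! ### Weighted symmetric functions and traces -/

theorem weightedSigma_zero (μ₀ : ℝ) (μ : Multiset ℝ) : weightedSigma μ₀ μ 0 = 1 := by
  rw [weightedSigma]

/-- Newton's identities for `σ_k^∞`, with the first power sum shifted by `μ₀`. -/
theorem weightedSigma_succ (μ₀ : ℝ) (μ : Multiset ℝ) (m : ℕ) :
    ((m : ℝ) + 1) * weightedSigma μ₀ μ (m + 1) =
      ∑ i ∈ Finset.range (m + 1), (-1) ^ i * weightedSigma μ₀ μ (m - i) *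
        ((if i = 0 then μ₀ else 0) + (μ.map fun t => t ^ (i + 1)).sum) := by
  rw [weightedSigma, mul_div_cancel₀ _ (by positivity), Finset.sum_range_succ']
  rw [Finset.sum_range fun i => (-1 : ℝ) ^ (i + 1) * weightedSigma μ₀ μ (m - (i + 1)) *
    ((if i + 1 = 0 then μ₀ else 0) + (μ.map fun t => t ^ (i + 1 + 1)).sum), add_comm]
  simp [Nat.sub_sub, add_comm 1]

/-- The sum of the `j`-th powers of the eigenvalues of an endomorphism that is self-adjoint for an
inner product is the trace of its `j`-th power. -/
theorem sum_pow_eigenvalueMultiset {V : Type*} [AddCommGroup V] [Module ℝ V]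
    [FiniteDimensional ℝ V] (B : V →ₗ[ℝ] V →ₗ[ℝ] ℝ) (hB : ∀ v w, B v w = B w v)
    (hpos : ∀ v, v ≠ 0 → 0 < B v v) (A : V →ₗ[ℝ] V) (hA : ∀ v w, B (A v) w = B v (A w)) (j : ℕ) :
    ((eigenvalueMultiset A).map fun t => t ^ j).sum = LinearMap.trace ℝ V (A ^ j) := by
  let c : InnerProductSpace.Core ℝ V :=
    { inner := fun v w => B v w
      conj_inner_symm := fun v w => hB w v
      re_inner_nonneg := fun v => by
        by_cases hv : v = 0
        · simp [hv]
        · exact (hpos v hv).le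
      add_left := fun u v w => by simp
      smul_left := fun u v r => by simp
      definite := fun v hv => by
        by_contra h
        exact (hpos v h).ne' hv }
  let _ : NormedAddCommGroup V := c.toNormedAddCommGroup
  let _ : InnerProductSpace ℝ V := InnerProductSpace.ofCore c.toCore
  have hs : A.IsSymmetric := hA
  rw [eigenvalueMultiset, hs.roots_charpoly_eq_eigenvalues rfl,
    LinearMap.trace_eq_matrix_trace ℝ (hs.eigenvectorBasis rfl).toBasis, ← LinearMap.toMatrix_pow,
    hs.toMatrix_eigenvectorBasis rfl, Matrix.diagonal_pow, Matrix.trace_diagonal]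
  simp [List.sum_ofFn]

/-- The recursion satisfied by the derivative of `σ_k^∞`, solved. -/
theorem newton_recursion_deriv (s q s' q' : ℕ → ℝ) (hs0' : s' 0 = 0)
    (hs : ∀ m : ℕ, ((m : ℝ) + 1) * s (m + 1) =
      ∑ i ∈ Finset.range (m + 1), (-1) ^ i * s (m - i) * q i)
    (hs' : ∀ m : ℕ, ((m : ℝ) + 1) * s' (m + 1) =
      ∑ i ∈ Finset.range (m + 1), ((-1) ^ i * s' (m - i) * q i + (-1) ^ i * s (m - i) * q' i))
    (m : ℕ) :
    s' m = ∑ j ∈ Finset.range m, (-1) ^ j * s (m - 1 - j) * (q' j / ((j : ℝ) + 1)) := by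
  induction m using Nat.strong_induction_on with
  | _ m ih =>
    rcases m with _ | m
    · simpa using hs0'
    have hm : ((m : ℝ) + 1) ≠ 0 := by positivity
    apply mul_left_cancel₀ hm
    rw [hs', Finset.sum_add_distrib]
    have h1 : ∑ i ∈ Finset.range (m + 1), (-1) ^ i * s' (m - i) * q i =
        ∑ i ∈ Finset.range (m + 1), ∑ j ∈ Finset.range (m - i),
          (-1) ^ j * (q' j / ((j : ℝ) + 1)) * ((-1) ^ i * s (m - 1 - j - i) * q i) := by
      refine Finset.sum_congr rfl fun i hi => ?_
      rw [ih (m - i) (by omega), Finset.mul_sum, Finset.sum_mul]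
      refine Finset.sum_congr rfl fun j hj => ?_
      rw [show m - i - 1 - j = m - 1 - j - i by omega]
      ring
    have h2 : ∑ i ∈ Finset.range (m + 1), (-1) ^ i * s' (m - i) * q i =
        ∑ j ∈ Finset.range (m + 1), (-1) ^ j * (q' j / ((j : ℝ) + 1)) *
          (((m - j : ℕ) : ℝ) * s (m - j)) := by
      rw [h1, Finset.sum_comm' (t' := Finset.range (m + 1)) (s' := fun j => Finset.range (m - j))
        (by intro i j; simp only [Finset.mem_range]; omega)]
      refine Finset.sum_congr rfl fun j hj => ?_
      rw [← Finset.mul_sum]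
      congr 1
      rcases hmj : m - j with _ | l
      · simp
      · rw [Nat.cast_succ, hs]
        refine Finset.sum_congr rfl fun i hi => ?_
        rw [show m - 1 - j - i = l - i by omega]
    rw [h2, ← Finset.sum_add_distrib, Finset.mul_sum]
    refine Finset.sum_congr rfl fun j hj => ?_
    have hj' : j ≤ m := by simpa [Nat.lt_succ_iff] using hj
    have : ((j : ℝ) + 1) ≠ 0 := by positivity
    rw [Nat.cast_sub hj', Nat.add_sub_cancel]
    field_simp
    ring

section Variation

variable {W E : Type*} [NormedAddCommGroup W] [NormedSpace ℝ W] [NormedAddCommGroup E]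
  [NormedSpace ℝ E]

/-- The trace of a continuous endomorphism. -/
noncomputable def clmTrace (E : Type*) [NormedAddCommGroup E] [NormedSpace ℝ E] [FiniteDimensional ℝ E] :
    (E →L[ℝ] E) →L[ℝ] ℝ :=
  LinearMap.toContinuousLinearMap (LinearMap.trace ℝ E ∘ₗ ContinuousLinearMap.coeLM ℝ)

theorem clmTrace_apply [FiniteDimensional ℝ E] (a : E →L[ℝ] E) :
    clmTrace E a = LinearMap.trace ℝ E (a : E →ₗ[ℝ] E) := rfl

theorem clmTrace_mul_comm [FiniteDimensional ℝ E] (a b : E →L[ℝ] E) :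
    clmTrace E (a * b) = clmTrace E (b * a) :=
  LinearMap.trace_mul_comm ℝ (a : E →ₗ[ℝ] E) (b : E →ₗ[ℝ] E)

theorem fderiv_clmTrace_pow [FiniteDimensional ℝ E] {a : W → E →L[ℝ] E} {y : W}
    (ha : DifferentiableAt ℝ a y) (j : ℕ) (v : W) :
    fderiv ℝ (fun z => clmTrace E (a z ^ (j + 1))) y v =
      ((j : ℝ) + 1) * clmTrace E (a y ^ j * fderiv ℝ a y v) := by
  have h1 := (clmTrace E).hasFDerivAt.comp y (ha.hasFDerivAt.pow' (j + 1))
  have h2 : HasFDerivAt (fun z => clmTrace E (a z ^ (j + 1))) _ y := h1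
  rw [h2.fderiv]
  have h3 : ∀ i ∈ Finset.range (j + 1),
      clmTrace E (a y ^ (j - i) * fderiv ℝ a y v * a y ^ i) =
        clmTrace E (a y ^ j * fderiv ℝ a y v) := by
    intro i hi
    rw [clmTrace_mul_comm, ← mul_assoc, ← pow_add,
      Nat.add_sub_cancel' (by simpa [Nat.lt_succ_iff] using hi)]
  simp only [Finset.mem_range, Nat.lt_succ_iff] at h3
  simp [mul_assoc] at h3 ⊢
  rw [Finset.sum_congr rfl fun i hi => h3 i (Nat.lt_succ_iff.1 (Finset.mem_range.1 hi))]
  simp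

/-- The Newton transformations `t_0 = 1`, `t_k = s_k - a t_{k-1}` attached to a sequence `s`. -/
noncomputable def newtonTransform (s : ℕ → ℝ) (a : E →L[ℝ] E) : ℕ → (E →L[ℝ] E)
  | 0 => 1
  | k + 1 => s (k + 1) • (1 : E →L[ℝ] E) - a * newtonTransform s a k

theorem newtonTransform_eq_sum (s : ℕ → ℝ) (hs : s 0 = 1) (a : E →L[ℝ] E) (k : ℕ) :
    newtonTransform s a k = ∑ j ∈ Finset.range (k + 1), ((-1) ^ j * s (k - j)) • a ^ j := by
  induction k with
  | zero => simp [newtonTransform, hs]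
  | succ k ih =>
    rw [newtonTransform, ih, Finset.sum_range_succ' _ (k + 1), Finset.mul_sum, sub_eq_add_neg, add_comm]
    congr 1
    · rw [← Finset.sum_neg_distrib]
      refine Finset.sum_congr rfl fun j hj => ?_
      rw [mul_smul_comm, ← pow_succ', ← neg_smul, Nat.add_sub_add_right]
      congr 1
      ring
    · simp

/-- A sequence of functions satisfying Newton's identities for the power sums of `(m, a)`. -/
structure IsNewtonSequence [FiniteDimensional ℝ E] (m : W → ℝ) (a : W → E →L[ℝ] E)
    (s : ℕ → W → ℝ) (y : W) : Prop where
  zero : ∀ᶠ z in 𝓝 y, s 0 z = 1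
  succ : ∀ᶠ z in 𝓝 y, ∀ k : ℕ, ((k : ℝ) + 1) * s (k + 1) z =
    ∑ i ∈ Finset.range (k + 1), (-1) ^ i * s (k - i) z *
      ((if i = 0 then m z else 0) + clmTrace E (a z ^ (i + 1)))

variable [FiniteDimensional ℝ E] {m : W → ℝ} {a : W → E →L[ℝ] E} {s : ℕ → W → ℝ} {y : W}

theorem differentiableAt_powerSum (hm : DifferentiableAt ℝ m y) (ha : DifferentiableAt ℝ a y)
    (i : ℕ) :
    DifferentiableAt ℝ (fun z => (if i = 0 then m z else 0) + clmTrace E (a z ^ (i + 1))) y := by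
  refine DifferentiableAt.add ?_ ((clmTrace E).differentiableAt.comp y (ha.pow _))
  split_ifs
  · exact hm
  · exact differentiableAt_const _

omit [NormedSpace ℝ W] in
theorem IsNewtonSequence.eventuallyEq (h : IsNewtonSequence m a s y) (k : ℕ) :
    s (k + 1) =ᶠ[𝓝 y] fun z => (((k : ℝ) + 1)⁻¹) * ∑ i ∈ Finset.range (k + 1),
      (-1) ^ i * s (k - i) z *
        ((if i = 0 then m z else 0) + clmTrace E (a z ^ (i + 1))) := by
  filter_upwards [h.succ] with z hz
  rw [← hz k, inv_mul_cancel_left₀ (by positivity)]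

theorem IsNewtonSequence.differentiableAt (h : IsNewtonSequence m a s y)
    (hm : DifferentiableAt ℝ m y) (ha : DifferentiableAt ℝ a y) (k : ℕ) :
    DifferentiableAt ℝ (s k) y := by
  induction k using Nat.strong_induction_on with
  | _ k ih =>
    rcases k with _ | k
    · exact (differentiableAt_const (1 : ℝ)).congr_of_eventuallyEq h.zero
    · refine DifferentiableAt.congr_of_eventuallyEq ?_ (h.eventuallyEq k)
      refine DifferentiableAt.const_mul (DifferentiableAt.fun_sum fun i hi => ?_) _
      exact ((ih (k - i) (by omega)).const_mul _).mul (differentiableAt_powerSum hm ha i)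

/-- The variation of the weighted symmetric functions:
`dσ_{k+1} = σ_k dμ₀ + tr (T_k dA)`. -/
theorem IsNewtonSequence.fderiv_succ (h : IsNewtonSequence m a s y)
    (hm : DifferentiableAt ℝ m y) (ha : DifferentiableAt ℝ a y) (k : ℕ) (v : W) :
    fderiv ℝ (s (k + 1)) y v = s k y * fderiv ℝ m y v +
      clmTrace E (newtonTransform (fun i => s i y) (a y) k * fderiv ℝ a y v) := by
  have hd := h.differentiableAt hm ha
  have key := newton_recursion_deriv (fun i => s i y)
    (fun i => (if i = 0 then m y else 0) + clmTrace E (a y ^ (i + 1)))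
    (fun i => fderiv ℝ (s i) y v)
    (fun i => fderiv ℝ (fun z => (if i = 0 then m z else 0) + clmTrace E (a z ^ (i + 1))) y v)
    (by
      have h0 : s 0 =ᶠ[𝓝 y] fun _ => 1 := h.zero
      simp [h0.fderiv_eq])
    h.succ.self_of_nhds
    (by
      intro k
      have hterm : ∀ i ∈ Finset.range (k + 1), HasFDerivAt (fun z => (-1) ^ i * s (k - i) z *
          ((if i = 0 then m z else 0) + clmTrace E (a z ^ (i + 1)))) _ y := fun i _ =>
        ((hd (k - i)).hasFDerivAt.const_mul ((-1) ^ i)).mul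
          (differentiableAt_powerSum hm ha i).hasFDerivAt
      have h1 := ((HasFDerivAt.fun_sum hterm).const_mul (((k : ℝ) + 1)⁻¹)).congr_of_eventuallyEq
        (h.eventuallyEq k)
      have h2 : ((k : ℝ) + 1) ≠ 0 := by positivity
      rw [h1.fderiv, smul_apply, smul_eq_mul, mul_inv_cancel_left₀ h2,
        sum_apply]
      refine Finset.sum_congr rfl fun i hi => ?_
      simp only [add_apply, smul_apply, smul_eq_mul]
      ring)
    (k + 1)
  have hq : ∀ i : ℕ,
      fderiv ℝ (fun z => (if i = 0 then m z else 0) + clmTrace E (a z ^ (i + 1))) y v =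
        (if i = 0 then fderiv ℝ m y v else 0) +
          ((i : ℝ) + 1) * clmTrace E (a y ^ i * fderiv ℝ a y v) := by
    intro i
    rw [← fderiv_clmTrace_pow ha]
    have h3 : DifferentiableAt ℝ (fun z => clmTrace E (a z ^ (i + 1))) y :=
      (clmTrace E).differentiableAt.comp y (ha.pow _)
    by_cases hi : i = 0
    · simp only [hi, if_true] at h3 ⊢
      rw [fderiv_fun_add hm h3]
      rfl
    · simp [hi]
  rw [key, newtonTransform_eq_sum _ h.zero.self_of_nhds, Finset.sum_mul, map_sum]
  simp only [hq]
  have hsplit : ∀ j ∈ Finset.range (k + 1), (-1 : ℝ) ^ j * s (k + 1 - 1 - j) y *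
      (((if j = 0 then fderiv ℝ m y v else 0) +
        ((j : ℝ) + 1) * clmTrace E (a y ^ j * fderiv ℝ a y v)) / ((j : ℝ) + 1)) =
      (if j = 0 then s k y * fderiv ℝ m y v else 0) +
        clmTrace E (((-1 : ℝ) ^ j * s (k - j) y) • a y ^ j * fderiv ℝ a y v) := by
    intro j hj
    have h2 : ((j : ℝ) + 1) ≠ 0 := by positivity
    rw [smul_mul_assoc, map_smul, smul_eq_mul, Nat.add_sub_cancel]
    by_cases h0 : j = 0
    · simp [h0]; ring
    · simp only [h0, if_false, zero_add]
      field_simp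
  rw [Finset.sum_congr rfl hsplit, Finset.sum_add_distrib]
  simp

end Variation

/-! ### The Levi-Civita connection and the curvature in a chart -/

section Local

variable {W E F : Type*} [NormedAddCommGroup W] [NormedSpace ℝ W]
  [NormedAddCommGroup E] [NormedSpace ℝ E] [NormedAddCommGroup F] [NormedSpace ℝ F]

theorem ContDiffAt.of_clm_apply [FiniteDimensional ℝ E] {n : WithTop ℕ∞} {f : W → E →L[ℝ] F}
    {x : W} (h : ∀ v, ContDiffAt ℝ n (fun y => f y v) x) : ContDiffAt ℝ n f x := by
  let d := Module.finrank ℝ E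
  have hd : d = Module.finrank ℝ (Fin d → ℝ) := (Module.finrank_fin_fun ℝ).symm
  let e₁ := ContinuousLinearEquiv.ofFinrankEq hd
  let e₂ := (e₁.arrowCongr (1 : F ≃L[ℝ] F)).trans (ContinuousLinearEquiv.piRing (Fin d))
  rw [← Function.id_comp f, ← e₂.symm_comp_self]
  exact e₂.symm.contDiff.contDiffAt.comp x (contDiffAt_pi.mpr fun i => h _)

theorem DifferentiableAt.of_clm_apply [FiniteDimensional ℝ E] {f : W → E →L[ℝ] F}
    {x : W} (h : ∀ v, DifferentiableAt ℝ (fun y => f y v) x) : DifferentiableAt ℝ f x := by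
  let d := Module.finrank ℝ E
  have hd : d = Module.finrank ℝ (Fin d → ℝ) := (Module.finrank_fin_fun ℝ).symm
  let e₁ := ContinuousLinearEquiv.ofFinrankEq hd
  let e₂ := (e₁.arrowCongr (1 : F ≃L[ℝ] F)).trans (ContinuousLinearEquiv.piRing (Fin d))
  rw [← Function.id_comp f, ← e₂.symm_comp_self]
  exact e₂.symm.differentiableAt.comp x (differentiableAt_pi.mpr fun i => h _)

theorem HasFDerivAt.clm_apply₂ {G : Type*} [NormedAddCommGroup G] [NormedSpace ℝ G]
    {c : W → E →L[ℝ] F →L[ℝ] G} {c' : W →L[ℝ] E →L[ℝ] F →L[ℝ] G} {u : W → E} {u' : W →L[ℝ] E}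
    {v : W → F} {v' : W →L[ℝ] F} {x : W} (hc : HasFDerivAt c c' x) (hu : HasFDerivAt u u' x)
    (hv : HasFDerivAt v v' x) (w : W) :
    fderiv ℝ (fun y => c y (u y) (v y)) x w =
      c' w (u x) (v x) + c x (u' w) (v x) + c x (u x) (v' w) := by
  rw [((hc.clm_apply hu).clm_apply hv).fderiv]
  simp
  abel

/-- A Riemannian metric of class `C²` near the point `y` of a vector space. -/
structure IsMetricNear (h : E → E →L[ℝ] E →L[ℝ] ℝ) (y : E) : Prop where
  contDiffAt : ContDiffAt ℝ 2 h y
  symm : ∀ᶠ z in 𝓝 y, ∀ u v, h z u v = h z v u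
  pos : ∀ᶠ z in 𝓝 y, ∀ u, u ≠ 0 → 0 < h z u u

theorem isInvertible_of_pos [FiniteDimensional ℝ E] {b : E →L[ℝ] E →L[ℝ] ℝ}
    (hb : ∀ u, u ≠ 0 → 0 < b u u) : b.IsInvertible := by
  have hinj : Function.Injective b := by
    rw [injective_iff_map_eq_zero]
    intro u hu
    by_contra h0
    simpa [hu] using hb u h0
  have hfr : Module.finrank ℝ E = Module.finrank ℝ (E →L[ℝ] ℝ) := by
    rw [← (LinearMap.toContinuousLinearMap (𝕜 := ℝ) (E := E) (F' := ℝ)).finrank_eq]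
    exact (Subspace.dual_finrank_eq (K := ℝ) (V := E)).symm
  exact ⟨(LinearEquiv.ofInjectiveOfFinrankEq (b : E →ₗ[ℝ] E →L[ℝ] ℝ) hinj
    hfr).toContinuousLinearEquiv, by ext; rfl⟩

theorem eq_of_forall_pairing {b : E →L[ℝ] E →L[ℝ] ℝ} (hb : ∀ u, u ≠ 0 → 0 < b u u)
    {u v : E} (h : ∀ w, b u w = b v w) : u = v := by
  by_contra hne
  have h1 := hb (u - v) (sub_ne_zero.2 hne)
  rw [map_sub b, sub_apply, h, sub_self] at h1
  exact lt_irrefl _ h1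

namespace IsMetricNear

variable {h : E → E →L[ℝ] E →L[ℝ] ℝ} {y : E}

theorem eventually_nhds (hh : IsMetricNear h y) : ∀ᶠ z in 𝓝 y, IsMetricNear h z := by
  filter_upwards [hh.contDiffAt.eventually (by simp), hh.symm.eventually_nhds,
    hh.pos.eventually_nhds] with z h1 h2 h3 using ⟨h1, h2, h3⟩

theorem differentiableAt (hh : IsMetricNear h y) : DifferentiableAt ℝ h y :=
  hh.contDiffAt.differentiableAt (by norm_num)

theorem hasFDerivAt (hh : IsMetricNear h y) : HasFDerivAt h (fderiv ℝ h y) y :=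
  hh.differentiableAt.hasFDerivAt

theorem fderiv_symm (hh : IsMetricNear h y) (p u v : E) :
    fderiv ℝ h y p u v = fderiv ℝ h y p v u := by
  have h1 : ∀ a b : E, fderiv ℝ (fun z => h z a b) y p = fderiv ℝ h y p a b := fun a b => by
    rw [hh.hasFDerivAt.clm_apply₂ (hasFDerivAt_const a y) (hasFDerivAt_const b y)]
    simp
  rw [← h1 u v, ← h1 v u]
  have h2 : (fun z => h z u v) =ᶠ[𝓝 y] fun z => h z v u := by
    filter_upwards [hh.symm] with z hz using hz u v
  rw [h2.fderiv_eq]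

variable [FiniteDimensional ℝ E]

theorem isInvertible (hh : IsMetricNear h y) : (h y).IsInvertible :=
  isInvertible_of_pos hh.pos.self_of_nhds

theorem christoffel_comm (hh : IsMetricNear h y) (u v : E) :
    christoffel h y u v = christoffel h y v u := by
  refine eq_of_forall_pairing hh.pos.self_of_nhds fun w => ?_
  rw [christoffel_spec h y hh.isInvertible, christoffel_spec h y hh.isInvertible,
    hh.fderiv_symm w u v]
  ring

/-- The Levi-Civita connection is compatible with the metric. -/
theorem fderiv_eq (hh : IsMetricNear h y) (p u v : E) :
    fderiv ℝ h y p u v = h y (christoffel h y p u) v + h y u (christoffel h y p v) := by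
  rw [hh.symm.self_of_nhds u, christoffel_spec h y hh.isInvertible,
    christoffel_spec h y hh.isInvertible, hh.fderiv_symm p v u, hh.fderiv_symm u p v,
    hh.fderiv_symm v p u]
  ring

end IsMetricNear

/-- The Christoffel symbols as a continuous bilinear map. -/
noncomputable def christoffelL [FiniteDimensional ℝ E] (h : E → E →L[ℝ] E →L[ℝ] ℝ) (y : E) :
    E →L[ℝ] E →L[ℝ] E :=
  LinearMap.toContinuousLinearMap
    ((LinearMap.toContinuousLinearMap (𝕜 := ℝ) (E := E) (F' := E)).toLinearMap ∘ₗ christoffel h y)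

@[simp]
theorem christoffelL_apply [FiniteDimensional ℝ E] (h : E → E →L[ℝ] E →L[ℝ] ℝ) (y u v : E) :
    christoffelL h y u v = christoffel h y u v := rfl

variable [FiniteDimensional ℝ E]

theorem IsMetricNear.differentiableAt_christoffelL {h : E → E →L[ℝ] E →L[ℝ] ℝ} {y : E}
    (hh : IsMetricNear h y) : DifferentiableAt ℝ (christoffelL h) y := by
  refine .of_clm_apply fun u => .of_clm_apply fun v => ?_
  obtain ⟨L, hL⟩ := hh.isInvertible
  have : CompleteSpace E := FiniteDimensional.complete ℝ E
  have h1 : DifferentiableAt ℝ (fun z => (h z).inverse) y := by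
    refine DifferentiableAt.comp y (g := ContinuousLinearMap.inverse) ?_ hh.differentiableAt
    rw [← hL]
    exact (contDiffAt_map_inverse (n := 1) L).differentiableAt (by norm_num)
  have h2 : DifferentiableAt ℝ (fderiv ℝ h) y :=
    (hh.contDiffAt.fderiv_right (m := 1) (by norm_num)).differentiableAt (by norm_num)
  have h3 : DifferentiableAt ℝ (fun z => christoffelForm h z u v) y := by
    refine .of_clm_apply fun w => ?_
    simp only [christoffelForm]
    simp
    fun_prop
  exact h1.clm_apply h3

/-- The transformation law of the Christoffel symbols under pull-back of a metric: the tangential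
component of the Gauss formula. -/
theorem christoffel_pullback [FiniteDimensional ℝ F] {h : E → E →L[ℝ] E →L[ℝ] ℝ}
    {H : F → F →L[ℝ] F →L[ℝ] ℝ} {Ψ : E → F} {y : E} (hh : IsMetricNear h y)
    (hH : IsMetricNear H (Ψ y)) (hΨ : ContDiffAt ℝ 2 Ψ y)
    (hp : ∀ᶠ z in 𝓝 y, ∀ u v, h z u v = H (Ψ z) (fderiv ℝ Ψ z u) (fderiv ℝ Ψ z v)) (u v w : E) :
    H (Ψ y) (fderiv ℝ Ψ y (christoffel h y u v)) (fderiv ℝ Ψ y w) =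
      H (Ψ y) (christoffel H (Ψ y) (fderiv ℝ Ψ y u) (fderiv ℝ Ψ y v) +
        fderiv ℝ (fderiv ℝ Ψ) y u v) (fderiv ℝ Ψ y w) := by
  have h1 : DifferentiableAt ℝ (fderiv ℝ Ψ) y :=
    (hΨ.fderiv_right (m := 1) (by norm_num)).differentiableAt (by norm_num)
  have h2 : DifferentiableAt ℝ Ψ y := hΨ.differentiableAt (by norm_num)
  have hsymm : ∀ a b, fderiv ℝ (fderiv ℝ Ψ) y a b = fderiv ℝ (fderiv ℝ Ψ) y b a :=
    hΨ.isSymmSndFDerivAt (by simp)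
  have h3 : ∀ a b c, fderiv ℝ h y a b c =
      fderiv ℝ H (Ψ y) (fderiv ℝ Ψ y a) (fderiv ℝ Ψ y b) (fderiv ℝ Ψ y c) +
        H (Ψ y) (fderiv ℝ (fderiv ℝ Ψ) y a b) (fderiv ℝ Ψ y c) +
        H (Ψ y) (fderiv ℝ Ψ y b) (fderiv ℝ (fderiv ℝ Ψ) y a c) := fun a b c => by
    have e1 : (fun z => h z b c) =ᶠ[𝓝 y]
        fun z => H (Ψ z) (fderiv ℝ Ψ z b) (fderiv ℝ Ψ z c) := by
      filter_upwards [hp] with z hz using hz b c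
    have e2 := e1.fderiv_eq (𝕜 := ℝ)
    have e3 := hh.hasFDerivAt.clm_apply₂ (hasFDerivAt_const b y) (hasFDerivAt_const c y) a
    have e4 := HasFDerivAt.clm_apply₂ (c := fun z => H (Ψ z)) (hH.hasFDerivAt.comp y h2.hasFDerivAt)
      (by simpa using h1.hasFDerivAt.clm_apply (hasFDerivAt_const b y))
      (by simpa using h1.hasFDerivAt.clm_apply (hasFDerivAt_const c y)) a
    rw [e2] at e3
    rw [e4] at e3
    simpa using e3.symm
  have hHs := hH.symm.self_of_nhds
  rw [← hp.self_of_nhds, christoffel_spec h y hh.isInvertible, map_add,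
    add_apply, christoffel_spec H (Ψ y) hH.isInvertible, h3, h3, h3,
    hsymm v u, hsymm w u, hsymm w v, hHs (fderiv ℝ Ψ y u), hHs (fderiv ℝ Ψ y v)]
  ring

namespace IsMetricNear

variable {h : E → E →L[ℝ] E →L[ℝ] ℝ} {y : E}

theorem coordCurvature_eq (hh : IsMetricNear h y) (u v w : E) :
    coordCurvature h y u v w =
      fderiv ℝ (christoffelL h) y v u w - fderiv ℝ (christoffelL h) y u v w
        + christoffel h y v (christoffel h y u w) - christoffel h y u (christoffel h y v w) := by
  have h1 : ∀ a b c, fderiv ℝ (fun z => christoffel h z a b) y c =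
      fderiv ℝ (christoffelL h) y c a b := fun a b c => by
    have := hh.differentiableAt_christoffelL.hasFDerivAt.clm_apply₂ (hasFDerivAt_const a y)
      (hasFDerivAt_const b y) c
    simpa using this
  rw [coordCurvature, h1, h1]

theorem fderiv_christoffelL_comm (hh : IsMetricNear h y) (p u v : E) :
    fderiv ℝ (christoffelL h) y p u v = fderiv ℝ (christoffelL h) y p v u := by
  have h1 : ∀ a b : E, fderiv ℝ (fun z => christoffelL h z a b) y p =
      fderiv ℝ (christoffelL h) y p a b := fun a b => by
    rw [hh.differentiableAt_christoffelL.hasFDerivAt.clm_apply₂ (hasFDerivAt_const a y)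
      (hasFDerivAt_const b y)]
    simp
  rw [← h1 u v, ← h1 v u]
  have h2 : (fun z => christoffelL h z u v) =ᶠ[𝓝 y] fun z => christoffelL h z v u := by
    filter_upwards [hh.eventually_nhds] with z hz using hz.christoffel_comm u v
  rw [h2.fderiv_eq]

theorem coordCurvature_antisymm (hh : IsMetricNear h y) (u v w : E) :
    coordCurvature h y u v w = -coordCurvature h y v u w := by
  rw [hh.coordCurvature_eq, hh.coordCurvature_eq]
  abel

theorem coordCurvature_bianchi (hh : IsMetricNear h y) (u v w : E) :
    coordCurvature h y u v w + coordCurvature h y v w u + coordCurvature h y w u v = 0 := by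
  rw [hh.coordCurvature_eq, hh.coordCurvature_eq, hh.coordCurvature_eq,
    hh.fderiv_christoffelL_comm v u w, hh.fderiv_christoffelL_comm u v w,
    hh.fderiv_christoffelL_comm w v u, hh.christoffel_comm u w, hh.christoffel_comm v w,
    hh.christoffel_comm v u]
  abel

theorem coordCurvature_skew (hh : IsMetricNear h y) (u v w z : E) :
    h y (coordCurvature h y u v w) z = -h y (coordCurvature h y u v z) w := by
  have hsymm : ∀ a b, fderiv ℝ (fderiv ℝ h) y a b = fderiv ℝ (fderiv ℝ h) y b a :=
    hh.contDiffAt.isSymmSndFDerivAt (by simp)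
  have hd : DifferentiableAt ℝ (fderiv ℝ h) y :=
    (hh.contDiffAt.fderiv_right (m := 1) (by norm_num)).differentiableAt (by norm_num)
  have hΓ := hh.differentiableAt_christoffelL.hasFDerivAt
  have h1 : ∀ a b, fderiv ℝ (fderiv ℝ h) y b a w z =
      h y (christoffel h y b (christoffel h y a w)) z
        + h y (christoffel h y a w) (christoffel h y b z)
        + h y (fderiv ℝ (christoffelL h) y b a w) z
        + h y (christoffel h y b w) (christoffel h y a z)
        + h y w (christoffel h y b (christoffel h y a z))
        + h y w (fderiv ℝ (christoffelL h) y b a z) := fun a b => by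
    have e1 : (fun x => fderiv ℝ h x a w z) =ᶠ[𝓝 y]
        fun x => h x (christoffelL h x a w) z + h x w (christoffelL h x a z) := by
      filter_upwards [hh.eventually_nhds] with x hx using hx.fderiv_eq a w z
    have e2 := (hd.hasFDerivAt.clm_apply (hasFDerivAt_const a y)).clm_apply₂
      (hasFDerivAt_const w y) (hasFDerivAt_const z y) b
    have ew := (hΓ.clm_apply (hasFDerivAt_const a y)).clm_apply (hasFDerivAt_const w y)
    have ez := (hΓ.clm_apply (hasFDerivAt_const a y)).clm_apply (hasFDerivAt_const z y)
    have e3 := hh.hasFDerivAt.clm_apply₂ ew (hasFDerivAt_const z y) b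
    have e4 := hh.hasFDerivAt.clm_apply₂ (hasFDerivAt_const w y) ez b
    have e5 := ((hh.hasFDerivAt.clm_apply ew).clm_apply (hasFDerivAt_const z y)).differentiableAt
    have e6 := ((hh.hasFDerivAt.clm_apply (hasFDerivAt_const w y)).clm_apply ez).differentiableAt
    rw [e1.fderiv_eq, fderiv_fun_add e5 e6, add_apply, e3, e4] at e2
    simp [hh.fderiv_eq] at e2
    rw [← e2]
    ring
  have h2 := h1 u v
  have h3 := h1 v u
  have hs := hh.symm.self_of_nhds
  rw [hsymm, h3] at h2
  rw [hh.coordCurvature_eq, hh.coordCurvature_eq]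
  simp only [map_add, map_sub, add_apply, sub_apply]
  rw [hs _ w, hs _ w, hs _ w, hs _ w] at *
  linarith

theorem coordCurvature_pair_symm (hh : IsMetricNear h y) (u v w z : E) :
    h y (coordCurvature h y u v w) z = h y (coordCurvature h y w z u) v := by
  have hB : ∀ a b c d, h y (coordCurvature h y a b c) d + h y (coordCurvature h y b c a) d +
      h y (coordCurvature h y c a b) d = 0 := fun a b c d => by
    rw [← add_apply, ← map_add, ← add_apply, ← map_add,
      hh.coordCurvature_bianchi, map_zero, zero_apply]
  have hA : ∀ a b c d, h y (coordCurvature h y a b c) d = -h y (coordCurvature h y b a c) d :=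
    fun a b c d => by
      rw [hh.coordCurvature_antisymm, map_neg, neg_apply]
  have hS := hh.coordCurvature_skew
  linarith [hB u v w z, hB v w z u, hB w z u v, hB z u v w, hS u v w z, hS v w u z, hS w u v z,
    hS v w z u, hS w z v u, hS z v w u, hS w z u v, hS z u w v, hS u w z v, hS z u v w,
    hS u v z w, hS v z u w, hA u v w z, hA v w u z, hA w u v z, hA v w z u, hA w z v u,
    hA z v w u, hA w z u v, hA z u w v, hA u w z v, hA z u v w, hA u v z w, hA v z u w]

end IsMetricNear

end Local

/-! ### Hypersurfaces in a chart -/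

section LocalHypersurface

variable {E F : Type*} [NormedAddCommGroup E] [NormedSpace ℝ E]
  [NormedAddCommGroup F] [NormedSpace ℝ F]

/-- A hypersurface `Ψ` with induced metric `h`, unit normal `ν` and shape operator `a`, near a
point `y` of a vector space, in a vector space with metric `H`. -/
structure IsHypersurfaceNear (h : E → E →L[ℝ] E →L[ℝ] ℝ) (H : F → F →L[ℝ] F →L[ℝ] ℝ)
    (Ψ ν : E → F) (a : E → E →L[ℝ] E) (y : E) : Prop where
  metric : IsMetricNear h y
  ambient : IsMetricNear H (Ψ y)
  contDiffAt : ContDiffAt ℝ 2 Ψ y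
  contDiffAt_normal : ContDiffAt ℝ 2 ν y
  pullback : ∀ᶠ z in 𝓝 y, ∀ u v, h z u v = H (Ψ z) (fderiv ℝ Ψ z u) (fderiv ℝ Ψ z v)
  unit : ∀ᶠ z in 𝓝 y, H (Ψ z) (ν z) (ν z) = 1
  normal : ∀ᶠ z in 𝓝 y, ∀ u, H (Ψ z) (ν z) (fderiv ℝ Ψ z u) = 0
  shape : ∀ᶠ z in 𝓝 y, ∀ u w, h z (a z u) w =
    -H (Ψ z) (fderiv ℝ ν z u + christoffel H (Ψ z) (fderiv ℝ Ψ z u) (ν z)) (fderiv ℝ Ψ z w)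
  finrank : Module.finrank ℝ F = Module.finrank ℝ E + 1

namespace IsHypersurfaceNear

variable {h : E → E →L[ℝ] E →L[ℝ] ℝ} {H : F → F →L[ℝ] F →L[ℝ] ℝ} {Ψ ν : E → F}
  {a : E → E →L[ℝ] E} {y : E}

theorem eventually_nhds (S : IsHypersurfaceNear h H Ψ ν a y) :
    ∀ᶠ z in 𝓝 y, IsHypersurfaceNear h H Ψ ν a z := by
  filter_upwards [S.metric.eventually_nhds,
    S.contDiffAt.continuousAt.eventually S.ambient.eventually_nhds,
    S.contDiffAt.eventually (by simp), S.contDiffAt_normal.eventually (by simp),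
    S.pullback.eventually_nhds, S.unit.eventually_nhds, S.normal.eventually_nhds,
    S.shape.eventually_nhds] with z h1 h2 h3 h4 h5 h6 h7 h8
  exact ⟨h1, h2, h3, h4, h5, h6, h7, h8, S.finrank⟩

theorem hasFDerivAt (S : IsHypersurfaceNear h H Ψ ν a y) : HasFDerivAt Ψ (fderiv ℝ Ψ y) y :=
  (S.contDiffAt.differentiableAt (by norm_num)).hasFDerivAt

theorem hasFDerivAt_fderiv (S : IsHypersurfaceNear h H Ψ ν a y) :
    HasFDerivAt (fderiv ℝ Ψ) (fderiv ℝ (fderiv ℝ Ψ) y) y :=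
  ((S.contDiffAt.fderiv_right (m := 1) (by norm_num)).differentiableAt (by norm_num)).hasFDerivAt

theorem hasFDerivAt_fderiv_apply (S : IsHypersurfaceNear h H Ψ ν a y) (u : E) :
    HasFDerivAt (fun z => fderiv ℝ Ψ z u) ((fderiv ℝ (fderiv ℝ Ψ) y).flip u) y := by
  simpa using S.hasFDerivAt_fderiv.clm_apply (hasFDerivAt_const u y)

theorem hasFDerivAt_normal (S : IsHypersurfaceNear h H Ψ ν a y) :
    HasFDerivAt ν (fderiv ℝ ν y) y :=
  (S.contDiffAt_normal.differentiableAt (by norm_num)).hasFDerivAt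

theorem hasFDerivAt_fderiv_normal (S : IsHypersurfaceNear h H Ψ ν a y) :
    HasFDerivAt (fderiv ℝ ν) (fderiv ℝ (fderiv ℝ ν) y) y :=
  ((S.contDiffAt_normal.fderiv_right (m := 1) (by norm_num)).differentiableAt
    (by norm_num)).hasFDerivAt

theorem fderiv_comm (S : IsHypersurfaceNear h H Ψ ν a y) (u v : E) :
    fderiv ℝ (fderiv ℝ Ψ) y u v = fderiv ℝ (fderiv ℝ Ψ) y v u :=
  S.contDiffAt.isSymmSndFDerivAt (by simp) u v

variable [FiniteDimensional ℝ E] [FiniteDimensional ℝ F]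

theorem differentiableAt_shape (S : IsHypersurfaceNear h H Ψ ν a y) : DifferentiableAt ℝ a y := by
  refine .of_clm_apply fun u => ?_
  obtain ⟨L, hL⟩ := S.metric.isInvertible
  have : CompleteSpace E := FiniteDimensional.complete ℝ E
  have h1 : DifferentiableAt ℝ (fun z => (h z).inverse) y := by
    refine DifferentiableAt.comp y (g := ContinuousLinearMap.inverse) ?_ S.metric.differentiableAt
    rw [← hL]
    exact (contDiffAt_map_inverse (n := 1) L).differentiableAt (by norm_num)
  have hH : DifferentiableAt ℝ (fun z => H (Ψ z)) y :=
    S.ambient.differentiableAt.comp y S.hasFDerivAt.differentiableAt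
  have hΓ : DifferentiableAt ℝ (fun z => christoffelL H (Ψ z)) y :=
    S.ambient.differentiableAt_christoffelL.comp y S.hasFDerivAt.differentiableAt
  have hu := (S.hasFDerivAt_fderiv_apply u).differentiableAt
  have hν := S.hasFDerivAt_normal.differentiableAt
  have hν' := S.hasFDerivAt_fderiv_normal.differentiableAt
  have hΨ' := S.hasFDerivAt_fderiv.differentiableAt
  have h2 : DifferentiableAt ℝ (fun z => -(H (Ψ z) (fderiv ℝ ν z u +
      christoffelL H (Ψ z) (fderiv ℝ Ψ z u) (ν z)) ∘L fderiv ℝ Ψ z)) y :=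
    ((hH.clm_apply ((hν'.clm_apply (differentiableAt_const u)).add
      ((hΓ.clm_apply hu).clm_apply hν))).clm_comp hΨ').neg
  refine (h1.clm_apply h2).congr_of_eventuallyEq ?_
  filter_upwards [S.eventually_nhds] with z hz
  refine eq_of_forall_pairing hz.metric.pos.self_of_nhds fun w => ?_
  rw [hz.metric.isInvertible.self_apply_inverse, hz.shape.self_of_nhds]
  simp

/-- The Weingarten formula. -/
theorem weingarten (S : IsHypersurfaceNear h H Ψ ν a y) (u : E) :
    fderiv ℝ ν y u + christoffel H (Ψ y) (fderiv ℝ Ψ y u) (ν y) = -fderiv ℝ Ψ y (a y u) := by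
  set X := fderiv ℝ ν y u + christoffel H (Ψ y) (fderiv ℝ Ψ y u) (ν y) with hX
  have hs := S.ambient.symm.self_of_nhds
  have hpos := S.ambient.pos.self_of_nhds
  have hnu := S.unit.self_of_nhds
  have hno := S.normal.self_of_nhds
  have h1 : H (Ψ y) X (ν y) = 0 := by
    have e1 : (fun z => H (Ψ z) (ν z) (ν z)) =ᶠ[𝓝 y] fun _ => 1 := S.unit
    have e2 := HasFDerivAt.clm_apply₂ (c := fun z => H (Ψ z))
      (S.ambient.hasFDerivAt.comp y S.hasFDerivAt) S.hasFDerivAt_normal S.hasFDerivAt_normal u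
    rw [e1.fderiv_eq] at e2
    simp [S.ambient.fderiv_eq] at e2
    rw [hs (ν y), hs (ν y)] at e2
    rw [hX, map_add, add_apply]
    linarith
  have h2 : ∀ w, H (Ψ y) (X + fderiv ℝ Ψ y (a y u)) (fderiv ℝ Ψ y w) = 0 := fun w => by
    rw [map_add, add_apply, ← S.pullback.self_of_nhds, S.shape.self_of_nhds, ← hX]
    ring
  let L : E × ℝ →ₗ[ℝ] F := (fderiv ℝ Ψ y : E →ₗ[ℝ] F).coprod (LinearMap.toSpanSingleton ℝ F (ν y))
  have hL : ∀ p, L p = fderiv ℝ Ψ y p.1 + p.2 • ν y := fun p => by simp [L]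
  have hinj : Function.Injective L := by
    rw [injective_iff_map_eq_zero]
    rintro ⟨w, t⟩ hwt
    rw [hL] at hwt
    have ht : t = 0 := by
      have := congrArg (H (Ψ y) (ν y)) hwt
      simpa [hno, hnu] using this
    have hw : w = 0 := by
      by_contra h0
      have h3 := S.metric.pos.self_of_nhds w h0
      rw [S.pullback.self_of_nhds] at h3
      rw [ht] at hwt
      simp only [zero_smul, add_zero] at hwt
      simp [hwt] at h3
    rw [ht, hw]
    rfl
  have hsurj : Function.Surjective L :=
    (LinearMap.injective_iff_surjective_of_finrank_eq_finrank
      (by rw [S.finrank, Module.finrank_prod, Module.finrank_self])).1 hinj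
  rw [eq_neg_iff_add_eq_zero]
  refine eq_of_forall_pairing hpos fun z => ?_
  obtain ⟨p, rfl⟩ := hsurj z
  rw [hL, map_add, map_smul, h2, map_add, add_apply, h1, hs _ (ν y), hno]
  simp

omit [FiniteDimensional ℝ E] in
theorem shape_symm (S : IsHypersurfaceNear h H Ψ ν a y) (u w : E) :
    h y (a y u) w = h y u (a y w) := by
  have h1 : ∀ u w, h y (a y u) w = H (Ψ y) (ν y) (fderiv ℝ (fderiv ℝ Ψ) y u w +
      christoffel H (Ψ y) (fderiv ℝ Ψ y u) (fderiv ℝ Ψ y w)) := fun u w => by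
    have e1 : (fun z => H (Ψ z) (ν z) (fderiv ℝ Ψ z w)) =ᶠ[𝓝 y] fun _ => 0 := by
      filter_upwards [S.normal] with z hz using hz w
    have e2 := HasFDerivAt.clm_apply₂ (c := fun z => H (Ψ z))
      (S.ambient.hasFDerivAt.comp y S.hasFDerivAt) S.hasFDerivAt_normal
      (S.hasFDerivAt_fderiv_apply w) u
    rw [e1.fderiv_eq] at e2
    simp [S.ambient.fderiv_eq] at e2
    rw [S.shape.self_of_nhds, map_add, map_add, add_apply]
    linarith
  rw [h1, S.metric.symm.self_of_nhds u, h1, S.fderiv_comm, S.ambient.christoffel_comm]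

end IsHypersurfaceNear

/-- The covariant derivative `(∇_u t) w` of a field of endomorphisms, in coordinates. -/
noncomputable def coordCovDerivEnd (h : E → E →L[ℝ] E →L[ℝ] ℝ) (t : E → E →L[ℝ] E) (y u w : E) : E :=
  fderiv ℝ t y u w + christoffel h y u (t y w) - t y (christoffel h y u w)

variable [FiniteDimensional ℝ E] [FiniteDimensional ℝ F]

theorem IsMetricNear.coordCovDerivEnd_symm {h : E → E →L[ℝ] E →L[ℝ] ℝ} {y : E}
    (hh : IsMetricNear h y) {t : E → E →L[ℝ] E} (ht : DifferentiableAt ℝ t y)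
    (hs : ∀ᶠ z in 𝓝 y, ∀ u w, h z (t z u) w = h z u (t z w)) (p u w : E) :
    h y (coordCovDerivEnd h t y p u) w = h y u (coordCovDerivEnd h t y p w) := by
  have e1 : (fun z => h z (t z u) w) =ᶠ[𝓝 y] fun z => h z u (t z w) := by
    filter_upwards [hs] with z hz using hz u w
  have hu := ht.hasFDerivAt.clm_apply (hasFDerivAt_const u y)
  have hw := ht.hasFDerivAt.clm_apply (hasFDerivAt_const w y)
  have e2 := hh.hasFDerivAt.clm_apply₂ hu (hasFDerivAt_const w y) p
  have e3 := hh.hasFDerivAt.clm_apply₂ (hasFDerivAt_const u y) hw p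
  rw [e1.fderiv_eq, e3] at e2
  simp [hh.fderiv_eq] at e2
  have h1 := hs.self_of_nhds
  simp only [coordCovDerivEnd, map_add, map_sub, add_apply, sub_apply, h1]
  rw [h1] at e2
  linarith

namespace IsHypersurfaceNear

variable {h : E → E →L[ℝ] E →L[ℝ] ℝ} {H : F → F →L[ℝ] F →L[ℝ] ℝ} {Ψ ν : E → F}
  {a : E → E →L[ℝ] E} {y : E}

/-- The Codazzi equation. -/
theorem codazzi (S : IsHypersurfaceNear h H Ψ ν a y) (u w z : E) :
    h y (coordCovDerivEnd h a y u w) z - h y (coordCovDerivEnd h a y w u) z =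
      H (Ψ y) (coordCurvature H (Ψ y) (fderiv ℝ Ψ y u) (fderiv ℝ Ψ y w) (ν y))
        (fderiv ℝ Ψ y z) := by
  have hΓ : HasFDerivAt (fun z => christoffelL H (Ψ z)) _ y :=
    S.ambient.differentiableAt_christoffelL.hasFDerivAt.comp y S.hasFDerivAt
  have ha := S.differentiableAt_shape.hasFDerivAt
  have hν2 : ∀ b c, fderiv ℝ (fderiv ℝ ν) y b c = fderiv ℝ (fderiv ℝ ν) y c b :=
    S.contDiffAt_normal.isSymmSndFDerivAt (by simp)
  have key : ∀ u w, fderiv ℝ (fderiv ℝ ν) y w u +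
      (fderiv ℝ (christoffelL H) (Ψ y) (fderiv ℝ Ψ y w) (fderiv ℝ Ψ y u) (ν y) +
        christoffel H (Ψ y) (fderiv ℝ (fderiv ℝ Ψ) y w u) (ν y) +
        christoffel H (Ψ y) (fderiv ℝ Ψ y u) (fderiv ℝ ν y w)) =
      -(fderiv ℝ (fderiv ℝ Ψ) y w (a y u) + fderiv ℝ Ψ y (fderiv ℝ a y w u)) := fun u w => by
    have e1 : (fun z => fderiv ℝ ν z u + christoffelL H (Ψ z) (fderiv ℝ Ψ z u) (ν z)) =ᶠ[𝓝 y]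
        fun z => -fderiv ℝ Ψ z (a z u) := by
      filter_upwards [S.eventually_nhds] with z hz using hz.weingarten u
    have d1 := S.hasFDerivAt_fderiv_normal.clm_apply (hasFDerivAt_const u y)
    have d2 := (hΓ.clm_apply (S.hasFDerivAt_fderiv_apply u)).clm_apply S.hasFDerivAt_normal
    have d3 := (S.hasFDerivAt_fderiv.clm_apply (ha.clm_apply (hasFDerivAt_const u y))).neg
    have e2 := congrArg (fun L : E →L[ℝ] F => L w) (e1.fderiv_eq (𝕜 := ℝ))
    have d4 := (d1.add d2).fderiv
    have d5 := d3.fderiv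
    simp only [Pi.add_def, Pi.neg_def] at d4 d5
    rw [d4, d5] at e2
    simp at e2
    rw [← neg_add_rev] at e2
    rw [add_comm (fderiv ℝ (fderiv ℝ Ψ) y w (a y u)), ← e2]
    abel
  have gauss : ∀ b c, h y (christoffel h y b c) z =
      H (Ψ y) (christoffel H (Ψ y) (fderiv ℝ Ψ y b) (fderiv ℝ Ψ y c)) (fderiv ℝ Ψ y z) +
        H (Ψ y) (fderiv ℝ (fderiv ℝ Ψ) y b c) (fderiv ℝ Ψ y z) := fun b c => by
    rw [S.pullback.self_of_nhds, christoffel_pullback S.metric S.ambient S.contDiffAt S.pullback,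
      map_add, add_apply]
  have hR : coordCurvature H (Ψ y) (fderiv ℝ Ψ y u) (fderiv ℝ Ψ y w) (ν y) =
      -(fderiv ℝ (fderiv ℝ Ψ) y w (a y u) + fderiv ℝ Ψ y (fderiv ℝ a y w u)) +
        (fderiv ℝ (fderiv ℝ Ψ) y u (a y w) + fderiv ℝ Ψ y (fderiv ℝ a y u w)) -
        christoffel H (Ψ y) (fderiv ℝ Ψ y w) (fderiv ℝ Ψ y (a y u)) +
        christoffel H (Ψ y) (fderiv ℝ Ψ y u) (fderiv ℝ Ψ y (a y w)) := by
    have w1 := S.weingarten u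
    have w2 := S.weingarten w
    rw [S.ambient.coordCurvature_eq, ← key u w, ← neg_neg (_ + fderiv ℝ Ψ y (fderiv ℝ a y u w)),
      ← key w u, ← neg_neg (fderiv ℝ Ψ y (a y u)), ← w1, ← neg_neg (fderiv ℝ Ψ y (a y w)), ← w2,
      hν2 w u, S.fderiv_comm w u]
    simp only [map_add, map_neg]
    abel
  rw [hR]
  simp only [coordCovDerivEnd, map_add, map_sub, map_neg, add_apply, sub_apply, neg_apply, gauss,
    S.metric.christoffel_comm w u]
  simp only [S.pullback.self_of_nhds]
  ring

end IsHypersurfaceNear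

/-! ### Orthonormal bases -/

section Orthonormal

variable {ι : Type*} [Fintype ι] [DecidableEq ι] {b : E →L[ℝ] E →L[ℝ] ℝ} {e : ι → E}

theorem exists_basis_of_orthonormal (he : ∀ i j, b (e i) (e j) = if i = j then 1 else 0)
    (hcard : Fintype.card ι = Module.finrank ℝ E) :
    ∃ B : Module.Basis ι ℝ E, ⇑B = e ∧ ∀ v i, B.repr v i = b v (e i) := by
  have key : ∀ (c : ι → ℝ) i, b (∑ j, c j • e j) (e i) = c i := fun c i => by
    simp [he, sum_apply]
  have hli : LinearIndependent ℝ e := by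
    rw [Fintype.linearIndependent_iff]
    intro c hc i
    rw [← key c i, hc]
    simp
  rcases isEmpty_or_nonempty ι with hι | hι
  · have h0 : Module.finrank ℝ E = 0 := by rw [← hcard, Fintype.card_eq_zero]
    have := Module.finrank_zero_iff.1 h0
    exact ⟨Module.Basis.empty E, Subsingleton.elim _ _, fun v i => hι.elim i⟩
  · refine ⟨basisOfLinearIndependentOfCardEqFinrank hli hcard, by simp, fun v i => ?_⟩
    set B := basisOfLinearIndependentOfCardEqFinrank hli hcard
    have hB : ⇑B = e := by simp [B]
    conv_rhs => rw [← B.sum_repr v, hB, key]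

theorem sum_pairing_smul (he : ∀ i j, b (e i) (e j) = if i = j then 1 else 0)
    (hcard : Fintype.card ι = Module.finrank ℝ E) (v : E) : ∑ i, b v (e i) • e i = v := by
  obtain ⟨B, rfl, hr⟩ := exists_basis_of_orthonormal he hcard
  simp [← hr, B.sum_repr]

theorem clmTrace_eq_sum (he : ∀ i j, b (e i) (e j) = if i = j then 1 else 0)
    (hcard : Fintype.card ι = Module.finrank ℝ E) (t : E →L[ℝ] E) :
    clmTrace E t = ∑ i, b (t (e i)) (e i) := by
  obtain ⟨B, rfl, hr⟩ := exists_basis_of_orthonormal he hcard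
  rw [clmTrace_apply, LinearMap.trace_eq_matrix_trace ℝ B, Matrix.trace]
  simp [LinearMap.toMatrix_apply, hr]

end Orthonormal

/-! ### The divergence of the weighted Newton transformations in a chart -/

/-- The divergence of a field of endomorphisms, in coordinates. -/
noncomputable def coordDivergence {ι : Type*} [Fintype ι] (h : E → E →L[ℝ] E →L[ℝ] ℝ) (t : E → E →L[ℝ] E)
    (y : E) (e : ι → E) : E :=
  ∑ i, coordCovDerivEnd h t y (e i) (e i)

/-- The weighted divergence of a field of endomorphisms, in coordinates. -/
noncomputable def coordWeightedDivergence {ι : Type*} [Fintype ι] (h : E → E →L[ℝ] E →L[ℝ] ℝ) (φ : E → ℝ)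
    (t : E → E →L[ℝ] E) (y : E) (e : ι → E) : E :=
  Real.exp (φ y) • coordDivergence h (fun z => Real.exp (-φ z) • t z) y e

omit [FiniteDimensional ℝ E] in
theorem coordCovDerivEnd_mul {h : E → E →L[ℝ] E →L[ℝ] ℝ} {t t' : E → E →L[ℝ] E} {y : E}
    (ht : DifferentiableAt ℝ t y) (ht' : DifferentiableAt ℝ t' y) (u w : E) :
    coordCovDerivEnd h (fun z => t z * t' z) y u w =
      coordCovDerivEnd h t y u (t' y w) + t y (coordCovDerivEnd h t' y u w) := by
  simp only [coordCovDerivEnd]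
  rw [fderiv_fun_mul' ht ht']
  simp
  abel

omit [FiniteDimensional ℝ E] in
theorem coordCovDerivEnd_sub {h : E → E →L[ℝ] E →L[ℝ] ℝ} {t t' : E → E →L[ℝ] E} {y : E}
    (ht : DifferentiableAt ℝ t y) (ht' : DifferentiableAt ℝ t' y) (u w : E) :
    coordCovDerivEnd h (fun z => t z - t' z) y u w =
      coordCovDerivEnd h t y u w - coordCovDerivEnd h t' y u w := by
  simp only [coordCovDerivEnd]
  rw [fderiv_fun_sub ht ht']
  simp
  abel

omit [FiniteDimensional ℝ E] in
theorem coordCovDerivEnd_smul {h : E → E →L[ℝ] E →L[ℝ] ℝ} {c : E → ℝ} {t : E → E →L[ℝ] E}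
    {y : E} (hc : DifferentiableAt ℝ c y) (ht : DifferentiableAt ℝ t y) (u w : E) :
    coordCovDerivEnd h (fun z => c z • t z) y u w =
      fderiv ℝ c y u • t y w + c y • coordCovDerivEnd h t y u w := by
  simp only [coordCovDerivEnd]
  rw [fderiv_fun_smul hc ht]
  simp [smul_sub]
  abel

omit [FiniteDimensional ℝ E] in
theorem coordCovDerivEnd_one (h : E → E →L[ℝ] E →L[ℝ] ℝ) (y u w : E) :
    coordCovDerivEnd h (fun _ => 1) y u w = 0 := by
  simp [coordCovDerivEnd]

omit [FiniteDimensional ℝ E] in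
theorem newtonTransform_commute (s : ℕ → ℝ) (a : E →L[ℝ] E) (k : ℕ) :
    a * newtonTransform s a k = newtonTransform s a k * a := by
  induction k with
  | zero => simp [newtonTransform]
  | succ k ih =>
    rw [newtonTransform, mul_sub, sub_mul, ih, ← mul_assoc, ih]
    simp

theorem IsNewtonSequence.differentiableAt_newtonTransform {m : E → ℝ} {a : E → E →L[ℝ] E}
    {s : ℕ → E → ℝ} {y : E} (hs : IsNewtonSequence m a s y) (hm : DifferentiableAt ℝ m y)
    (ha : DifferentiableAt ℝ a y) (k : ℕ) :
    DifferentiableAt ℝ (fun z => newtonTransform (fun i => s i z) (a z) k) y := by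
  induction k with
  | zero => exact differentiableAt_const _
  | succ k ih =>
    exact ((hs.differentiableAt hm ha (k + 1)).smul (differentiableAt_const _)).sub (ha.mul ih)

section Divergence

variable {ι : Type*} [Fintype ι] [DecidableEq ι] {h : E → E →L[ℝ] E →L[ℝ] ℝ} {y : E} {e : ι → E}

theorem coordWeightedDivergence_eq
    (he : ∀ i j, h y (e i) (e j) = if i = j then 1 else 0)
    (hcard : Fintype.card ι = Module.finrank ℝ E) {φ : E → ℝ} (hφ : DifferentiableAt ℝ φ y)
    {t : E → E →L[ℝ] E} (ht : DifferentiableAt ℝ t y) {G : E} (hG : h y G = fderiv ℝ φ y) :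
    coordWeightedDivergence h φ t y e = coordDivergence h t y e - t y G := by
  have h1 : ∀ v, fderiv ℝ (fun z => Real.exp (-φ z)) y v = -(Real.exp (-φ y) * fderiv ℝ φ y v) :=
    fun v => by
      rw [hφ.hasFDerivAt.fun_neg.exp.fderiv]
      simp
  have h2 : ∀ w, Real.exp (φ y) • Real.exp (-φ y) • w = w := fun w : E => by
    rw [smul_smul, ← Real.exp_add, add_neg_cancel, Real.exp_zero, one_smul]
  rw [coordWeightedDivergence, coordDivergence, coordDivergence,
    ← sum_pairing_smul he hcard G, hG, map_sum, ← Finset.sum_sub_distrib, Finset.smul_sum]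
  refine Finset.sum_congr rfl fun i _ => ?_
  rw [coordCovDerivEnd_smul hφ.fun_neg.exp ht, h1, map_smul, neg_smul, mul_smul, smul_add, smul_neg,
    h2, h2]
  abel

namespace IsHypersurfaceNear

variable {H : F → F →L[ℝ] F →L[ℝ] ℝ} {Ψ ν : E → F} {a : E → E →L[ℝ] E}

theorem sum_pairing_coordCovDerivEnd_shape (S : IsHypersurfaceNear h H Ψ ν a y)
    (he : ∀ i j, h y (e i) (e j) = if i = j then 1 else 0)
    (hcard : Fintype.card ι = Module.finrank ℝ E) {t : E →L[ℝ] E} (ht : a y * t = t * a y)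
    (X : E) :
    ∑ i, h y (coordCovDerivEnd h a y (e i) (t (e i))) X = clmTrace E (t * fderiv ℝ a y X) +
      ∑ i, H (Ψ y) (coordCurvature H (Ψ y) (ν y) (fderiv ℝ Ψ y (t (e i)))
        (fderiv ℝ Ψ y (e i))) (fderiv ℝ Ψ y X) := by
  have hsymm := S.metric.coordCovDerivEnd_symm S.differentiableAt_shape
    (S.eventually_nhds.mono fun z hz => hz.shape_symm)
  have hs := S.metric.symm.self_of_nhds
  have h1 : ∀ i, h y (coordCovDerivEnd h a y (e i) (t (e i))) X =
      h y (coordCovDerivEnd h a y X (t (e i))) (e i) +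
      H (Ψ y) (coordCurvature H (Ψ y) (ν y) (fderiv ℝ Ψ y (t (e i)))
        (fderiv ℝ Ψ y (e i))) (fderiv ℝ Ψ y X) := fun i => by
    rw [hsymm, hs (t (e i)), ← S.ambient.coordCurvature_pair_symm, ← S.codazzi, hsymm X,
      hs (t (e i))]
    ring
  simp only [h1, Finset.sum_add_distrib]
  congr 1
  let Γ : E →L[ℝ] E := christoffelL h y X
  have h2 : ∀ i, coordCovDerivEnd h a y X (t (e i)) =
      (fderiv ℝ a y X * t + Γ * (a y * t) - a y * (Γ * t)) (e i) := fun i => rfl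
  simp only [h2]
  rw [← clmTrace_eq_sum he hcard, map_sub, map_add, clmTrace_mul_comm (fderiv ℝ a y X),
    clmTrace_mul_comm (a y), mul_assoc Γ, ← ht, add_sub_cancel_right]

/-- The divergence formula for the weighted Newton transformations, in coordinates. -/
theorem coordWeightedDivergence_succ (S : IsHypersurfaceNear h H Ψ ν a y)
    (he : ∀ i j, h y (e i) (e j) = if i = j then 1 else 0)
    (hcard : Fintype.card ι = Module.finrank ℝ E) {φ m : E → ℝ} (hφ : DifferentiableAt ℝ φ y)
    (hm : DifferentiableAt ℝ m y) {s : ℕ → E → ℝ} (hs : IsNewtonSequence m a s y) (k : ℕ)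
    {G Gm : E} (hG : h y G = fderiv ℝ φ y) (hGm : h y Gm = fderiv ℝ m y) {X : ι → E}
    (hX : ∀ i w, h y (X i) w = H (Ψ y) (coordCurvature H (Ψ y) (ν y)
      (fderiv ℝ Ψ y (newtonTransform (fun j => s j y) (a y) k (e i))) (fderiv ℝ Ψ y (e i)))
      (fderiv ℝ Ψ y w)) :
    coordWeightedDivergence h φ (fun z => newtonTransform (fun j => s j z) (a z) (k + 1)) y e =
      -(s (k + 1) y • G) + s k y • Gm
        - a y (coordWeightedDivergence h φ (fun z => newtonTransform (fun j => s j z) (a z) k) y e)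
        - ∑ i, X i := by
  have ha := S.differentiableAt_shape
  have ht := hs.differentiableAt_newtonTransform hm ha
  have hsd := hs.differentiableAt hm ha
  rw [coordWeightedDivergence_eq he hcard hφ (ht _) hG,
    coordWeightedDivergence_eq he hcard hφ (ht _) hG]
  set t : E → E →L[ℝ] E := fun z => newtonTransform (fun j => s j z) (a z) k with htk
  have h0 : ∀ z, newtonTransform (fun j => s j z) (a z) (k + 1) =
      s (k + 1) z • (1 : E →L[ℝ] E) - a z * t z := fun z => rfl
  have hsum : ∀ (f : ι → E) w, h y (∑ i, f i) w = ∑ i, h y (f i) w := fun f w => by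
    simp [sum_apply]
  have hdiv : coordDivergence h (fun z => newtonTransform (fun j => s j z) (a z) (k + 1)) y e =
      ∑ i, fderiv ℝ (s (k + 1)) y (e i) • e i -
        ∑ i, coordCovDerivEnd h a y (e i) (t y (e i)) - a y (coordDivergence h t y e) := by
    simp only [coordDivergence, h0, map_sum, ← Finset.sum_sub_distrib]
    refine Finset.sum_congr rfl fun i _ => ?_
    rw [coordCovDerivEnd_sub ((hsd _).fun_smul (differentiableAt_const _)) (ha.fun_mul (ht k)),
      coordCovDerivEnd_mul ha (ht k),
      coordCovDerivEnd_smul (t := fun _ => 1) (hsd _) (differentiableAt_const _),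
      coordCovDerivEnd_one]
    simp
    abel
  refine eq_of_forall_pairing S.metric.pos.self_of_nhds fun w => ?_
  have h1 : h y (∑ i, fderiv ℝ (s (k + 1)) y (e i) • e i) w = fderiv ℝ (s (k + 1)) y w := by
    rw [hsum]
    conv_rhs => rw [← sum_pairing_smul he hcard w, map_sum]
    refine Finset.sum_congr rfl fun i _ => ?_
    rw [map_smul, map_smul, smul_apply, smul_eq_mul, smul_eq_mul, mul_comm,
      S.metric.symm.self_of_nhds w]
  have h2 := S.sum_pairing_coordCovDerivEnd_shape he hcard (t := t y)
    (newtonTransform_commute (fun j => s j y) (a y) k) w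
  have h3 : _ = _ + clmTrace E (t y * _) := hs.fderiv_succ hm ha k w
  have hX' : ∀ i w, h y (X i) w = H (Ψ y) (coordCurvature H (Ψ y) (ν y)
    (fderiv ℝ Ψ y (t y (e i))) (fderiv ℝ Ψ y (e i))) (fderiv ℝ Ψ y w) := hX
  have h4 : newtonTransform (fun j => s j y) (a y) k = t y := rfl
  simp only [← hX'] at h2
  rw [hdiv, h0]
  simp only [map_sub, map_add, map_neg, map_smul, sub_apply, add_apply, neg_apply, smul_apply,
    hGm, h1, hsum, h2, h3, h4, one_apply_eq_self,
    mul_apply_eq_comp, smul_eq_mul]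
  ring

theorem coordWeightedDivergence_zero
    (he : ∀ i j, h y (e i) (e j) = if i = j then 1 else 0)
    (hcard : Fintype.card ι = Module.finrank ℝ E) {φ : E → ℝ} (hφ : DifferentiableAt ℝ φ y)
    {G : E} (hG : h y G = fderiv ℝ φ y) :
    coordWeightedDivergence h φ (fun _ => 1) y e = -G := by
  rw [coordWeightedDivergence_eq he hcard hφ (differentiableAt_const _) hG, coordDivergence]
  simp [coordCovDerivEnd_one]

end IsHypersurfaceNear

end Divergence

end LocalHypersurface

/-! ### Reading objects on a manifold in a chart -/

section Charts

variable {d : ℕ} {M : Type*} [TopologicalSpace M] [ChartedSpace (EuclideanSpace ℝ (Fin d)) M]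
  {V : Type*} [NormedAddCommGroup V] [NormedSpace ℝ V]

theorem eventually_extChartAt {x : M} {p : EuclideanSpace ℝ (Fin d) → Prop}
    (h : ∀ᶠ q in 𝓝 x, p (extChartAt (𝓡 d) x q)) : ∀ᶠ y in 𝓝 (extChartAt (𝓡 d) x x), p y := by
  rw [← map_extChartAt_nhds_of_boundaryless]
  exact h

theorem eventually_mem_source (x : M) : ∀ᶠ q in 𝓝 x, q ∈ (extChartAt (𝓡 d) x).source :=
  extChartAt_source_mem_nhds x

theorem eventually_mem_source_nhds {x q : M} (hq : q ∈ (extChartAt (𝓡 d) x).source) :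
    ∀ᶠ q' in 𝓝 q, q' ∈ (extChartAt (𝓡 d) x).source :=
  (isOpen_extChartAt_source x).mem_nhds hq

theorem tendsto_extChartAt_symm {x q : M} (hq : q ∈ (extChartAt (𝓡 d) x).source) :
    Tendsto (extChartAt (𝓡 d) x).symm (𝓝 (extChartAt (𝓡 d) x q)) (𝓝 q) := by
  have := continuousAt_extChartAt_symm' hq
  rwa [ContinuousAt, (extChartAt (𝓡 d) x).left_inv hq] at this

theorem comp_extChartAt_symm_apply {α : Type*} (f : M → α) {x q : M}
    (hq : q ∈ (extChartAt (𝓡 d) x).source) :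
    (f ∘ (extChartAt (𝓡 d) x).symm) (extChartAt (𝓡 d) x q) = f q :=
  congrArg f ((extChartAt (𝓡 d) x).left_inv hq)

variable [IsManifold (𝓡 d) ∞ M]

theorem isInvertible_chartDeriv {x q : M} (hq : q ∈ (extChartAt (𝓡 d) x).source) :
    (chartDeriv (d := d) x q).IsInvertible := by
  have : IsManifold (𝓡 d) 1 M := IsManifold.of_le (n := ∞) (by norm_cast)
  exact isInvertible_mfderiv_extChartAt hq

theorem hasMFDerivAt_extChartAt_source {x q : M} (hq : q ∈ (extChartAt (𝓡 d) x).source) :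
    HasMFDerivAt (𝓡 d) 𝓘(ℝ, EuclideanSpace ℝ (Fin d)) (extChartAt (𝓡 d) x) q
      (chartDeriv x q) := by
  have : IsManifold (𝓡 d) 1 M := IsManifold.of_le (n := ∞) (by norm_cast)
  exact (mdifferentiableAt_extChartAt (by rwa [extChartAt_source] at hq)).hasMFDerivAt

/-- The differential of a function, computed in a chart. -/
theorem hasMFDerivAt_of_coord {f : M → V} {x q : M} (hq : q ∈ (extChartAt (𝓡 d) x).source)
    (hf : DifferentiableAt ℝ (f ∘ (extChartAt (𝓡 d) x).symm) (extChartAt (𝓡 d) x q)) :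
    HasMFDerivAt (𝓡 d) 𝓘(ℝ, V) f q
      (fderiv ℝ (f ∘ (extChartAt (𝓡 d) x).symm) (extChartAt (𝓡 d) x q) ∘L chartDeriv x q) := by
  refine (HasMFDerivAt.comp q hf.hasFDerivAt.hasMFDerivAt
    (hasMFDerivAt_extChartAt_source hq)).congr_of_eventuallyEq ?_
  filter_upwards [eventually_mem_source_nhds hq] with q' hq'
  simp only [Function.comp_apply, (extChartAt (𝓡 d) x).left_inv hq']

theorem contDiffAt_coord {f : M → V} {x q : M} {n : WithTop ℕ∞} (hn : n ≤ ∞)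
    (hq : q ∈ (extChartAt (𝓡 d) x).source) (hf : ContMDiffAt (𝓡 d) 𝓘(ℝ, V) n f q) :
    ContDiffAt ℝ n (f ∘ (extChartAt (𝓡 d) x).symm) (extChartAt (𝓡 d) x q) := by
  have : IsManifold (𝓡 d) n M := IsManifold.of_le hn
  rw [← contMDiffAt_iff_contDiffAt]
  have h1 : ContMDiffAt 𝓘(ℝ, EuclideanSpace ℝ (Fin d)) (𝓡 d) n (extChartAt (𝓡 d) x).symm
      (extChartAt (𝓡 d) x q) :=
    (contMDiffOn_extChartAt_symm x).contMDiffAt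
      ((isOpen_extChartAt_target x).mem_nhds ((extChartAt (𝓡 d) x).map_source hq))
  refine ContMDiffAt.comp _ ?_ h1
  rwa [(extChartAt (𝓡 d) x).left_inv hq]

theorem contMDiffAt_extChartAt_source {x q : M} (hq : q ∈ (extChartAt (𝓡 d) x).source)
    {n : WithTop ℕ∞} (hn : n ≤ ∞) :
    ContMDiffAt (𝓡 d) 𝓘(ℝ, EuclideanSpace ℝ (Fin d)) n (extChartAt (𝓡 d) x) q := by
  have : IsManifold (𝓡 d) n M := IsManifold.of_le hn
  exact contMDiffAt_extChartAt' (by rwa [extChartAt_source] at hq)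

theorem trivializationAt_snd_eq_chartDeriv {x : M} (p : TangentBundle (𝓡 d) M)
    (hq : p.1 ∈ (extChartAt (𝓡 d) x).source) :
    (trivializationAt (EuclideanSpace ℝ (Fin d)) (TangentSpace (𝓡 d)) x p).2 =
      chartDeriv x p.1 p.2 := by
  have : IsManifold (𝓡 d) 1 M := IsManifold.of_le (n := ∞) (by norm_cast)
  have hq' : p.1 ∈ (chartAt (EuclideanSpace ℝ (Fin d)) x).source := by
    rwa [extChartAt_source] at hq
  have h1 := TangentBundle.continuousLinearMapAt_trivializationAt (I := 𝓡 d) hq'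
  rw [chartDeriv, ← h1, Trivialization.continuousLinearMapAt_apply,
    Trivialization.coe_linearMapAt_of_mem _ (by simpa using hq')]

theorem coordMetric_extChartAt (g : RiemMetric d M) {x q : M}
    (hq : q ∈ (extChartAt (𝓡 d) x).source) (u v : TangentSpace (𝓡 d) q) :
    coordMetric g x (extChartAt (𝓡 d) x q) (chartDeriv x q u) (chartDeriv x q v) =
      g.inner q u v := by
  have h1 := isInvertible_chartDeriv hq
  simp only [coordMetric]
  rw [(extChartAt (𝓡 d) x).left_inv hq]
  simp [h1.inverse_apply_self]

theorem isMetricNear_coordMetric (g : RiemMetric d M) (x : M) :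
    IsMetricNear (coordMetric g x) (extChartAt (𝓡 d) x x) := by
  have hx := mem_extChartAt_source (I := 𝓡 d) x
  have hinv : ∀ᶠ q in 𝓝 x, (chartDeriv (d := d) x q).IsInvertible :=
    (eventually_mem_source x).mono fun q hq => isInvertible_chartDeriv hq
  have hval : ∀ᶠ q in 𝓝 x, ∀ u v, coordMetric g x (extChartAt (𝓡 d) x q) u v =
      g.inner q ((chartDeriv x q).inverse u) ((chartDeriv x q).inverse v) := by
    filter_upwards [eventually_mem_source (d := d) x, hinv] with q hq hi u v
    rw [← coordMetric_extChartAt g hq, hi.self_apply_inverse, hi.self_apply_inverse]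
  refine ⟨.of_clm_apply fun u => .of_clm_apply fun v => ?_, eventually_extChartAt ?_,
    eventually_extChartAt ?_⟩
  · have hsec : ∀ w : EuclideanSpace ℝ (Fin d), ContMDiffAt (𝓡 d) (𝓡 d).tangent ∞
        (fun q => (⟨q, (chartDeriv x q).inverse w⟩ : TangentBundle (𝓡 d) M)) x := fun w => by
      rw [Bundle.contMDiffAt_section]
      refine (contMDiffAt_const (c := w)).congr_of_eventuallyEq ?_
      filter_upwards [eventually_mem_source (d := d) x, hinv] with q hq hi
      rw [trivializationAt_snd_eq_chartDeriv _ hq, hi.self_apply_inverse]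
    have h1 : ContMDiffAt (𝓡 d) ((𝓡 d).prod 𝓘(ℝ, ℝ)) ∞ (fun q => TotalSpace.mk' ℝ
        (E := Bundle.Trivial M ℝ) q
        (g.inner q ((chartDeriv x q).inverse u) ((chartDeriv x q).inverse v))) x :=
      ContMDiffAt.clm_bundle_apply₂ (F₁ := EuclideanSpace ℝ (Fin d))
        (F₂ := EuclideanSpace ℝ (Fin d)) g.contMDiff.contMDiffAt (hsec u) (hsec v)
    have h2 := (Bundle.contMDiffAt_totalSpace.1 h1).2
    have h3 : ContMDiffAt (𝓡 d) 𝓘(ℝ, ℝ) 2 (fun q =>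
        coordMetric g x (extChartAt (𝓡 d) x q) u v) x := by
      refine (ContMDiffAt.of_le h2 (by norm_cast)).congr_of_eventuallyEq ?_
      filter_upwards [hval] with q hq using hq u v
    have h4 := contDiffAt_coord (n := 2) (by norm_cast) hx h3
    refine h4.congr_of_eventuallyEq ?_
    filter_upwards [extChartAt_target_mem_nhds (I := 𝓡 d) x] with y hy
    simp only [Function.comp_apply, (extChartAt (𝓡 d) x).right_inv hy]
  · filter_upwards [hval] with q hq u v
    rw [hq, hq, g.symm]
  · filter_upwards [hval, hinv] with q hq hi u hu
    rw [hq]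
    refine g.pos q _ fun h0 => hu ?_
    rw [← hi.self_apply_inverse u, h0, map_zero]

end Charts

/-! ### The covariant derivative along a map, in arbitrary charts -/

section CovDeriv

variable {d n : ℕ} {M : Type*} [TopologicalSpace M] [ChartedSpace (EuclideanSpace ℝ (Fin d)) M]
  [IsManifold (𝓡 d) ∞ M] {S : Type*} [TopologicalSpace S]
  [ChartedSpace (EuclideanSpace ℝ (Fin n)) S]

/-- A vector field along `ψ`, read in the preferred chart around an arbitrary point `c`. -/
noncomputable def fieldInChart (ψ : S → M) (Y : ∀ q : S, TangentSpace (𝓡 d) (ψ q)) (c : M) (q : S) :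
    EuclideanSpace ℝ (Fin d) :=
  chartDeriv c (ψ q) (Y q)

/-- A map between manifolds, read in the preferred charts around `x` and `c`. -/
noncomputable def mapInCharts (ψ : S → M) (x : S) (c : M) :
    EuclideanSpace ℝ (Fin n) → EuclideanSpace ℝ (Fin d) :=
  (extChartAt (𝓡 d) c ∘ ψ) ∘ (extChartAt (𝓡 n) x).symm

/-- The differentials of two charts are related by the differential of the transition map. -/
theorem chartDeriv_eq_fderiv {c p q : M} (hp : q ∈ (extChartAt (𝓡 d) p).source)
    (hc : q ∈ (extChartAt (𝓡 d) c).source) (u : TangentSpace (𝓡 d) q) :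
    chartDeriv c q u =
      fderiv ℝ (extChartAt (𝓡 d) c ∘ (extChartAt (𝓡 d) p).symm) (extChartAt (𝓡 d) p q)
        (chartDeriv p q u) := by
  have h1 := contDiffAt_coord (n := 1) (by norm_cast) hp
    (contMDiffAt_extChartAt_source hc (by norm_cast))
  have h2 := hasMFDerivAt_of_coord hp (h1.differentiableAt (by norm_num))
  exact congrArg (fun L => L u) (hasMFDerivAt_unique (hasMFDerivAt_extChartAt_source hc) h2)

variable [IsManifold (𝓡 n) ∞ S]

theorem contDiffAt_mapInCharts {ψ : S → M} {x q : S} {c : M}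
    (hq : q ∈ (extChartAt (𝓡 n) x).source) (hc : ψ q ∈ (extChartAt (𝓡 d) c).source)
    (hψ : ContMDiffAt (𝓡 n) (𝓡 d) 2 ψ q) :
    ContDiffAt ℝ 2 (mapInCharts (d := d) (n := n) ψ x c) (extChartAt (𝓡 n) x q) :=
  contDiffAt_coord (by norm_cast) hq
    (ContMDiffAt.comp q (contMDiffAt_extChartAt_source hc (by norm_cast)) hψ)

theorem chartDeriv_mfderiv {ψ : S → M} {x q : S} {c : M}
    (hq : q ∈ (extChartAt (𝓡 n) x).source) (hc : ψ q ∈ (extChartAt (𝓡 d) c).source)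
    (hψ : ContMDiffAt (𝓡 n) (𝓡 d) 2 ψ q) (v : TangentSpace (𝓡 n) q) :
    chartDeriv c (ψ q) (mfderiv (𝓡 n) (𝓡 d) ψ q v) =
      fderiv ℝ (mapInCharts ψ x c) (extChartAt (𝓡 n) x q) (chartDeriv x q v) := by
  have h1 := (contDiffAt_mapInCharts hq hc hψ).differentiableAt (by norm_num)
  have h2 := hasMFDerivAt_of_coord hq h1
  have h3 := (hasMFDerivAt_extChartAt_source hc).comp q
    (hψ.mdifferentiableAt (by norm_num)).hasMFDerivAt
  exact congrArg (fun L => L v) (hasMFDerivAt_unique h3 h2)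

/-- The covariant derivative along a map in the chart that defines it. -/
theorem chartDeriv_covDerivAlong_self (g : RiemMetric d M) {ψ : S → M}
    {Y : ∀ q : S, TangentSpace (𝓡 d) (ψ q)} {x q : S}
    (hq : q ∈ (extChartAt (𝓡 n) x).source) (hψ : ContMDiffAt (𝓡 n) (𝓡 d) 2 ψ q)
    (hY : DifferentiableAt ℝ (fieldInChart ψ Y (ψ q) ∘ (extChartAt (𝓡 n) x).symm)
      (extChartAt (𝓡 n) x q)) (v : TangentSpace (𝓡 n) q) :
    chartDeriv (ψ q) (ψ q) (covDerivAlong g ψ Y q v) =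
      fderiv ℝ (fieldInChart ψ Y (ψ q) ∘ (extChartAt (𝓡 n) x).symm) (extChartAt (𝓡 n) x q)
        (chartDeriv x q v) +
      christoffel (coordMetric g (ψ q)) (extChartAt (𝓡 d) (ψ q) (ψ q))
        (fderiv ℝ (mapInCharts ψ x (ψ q)) (extChartAt (𝓡 n) x q) (chartDeriv x q v))
        (fieldInChart ψ Y (ψ q) q) := by
  have hp := mem_extChartAt_source (I := 𝓡 d) (ψ q)
  have h1 : mfderiv (𝓡 n) 𝓘(ℝ, EuclideanSpace ℝ (Fin d)) (coordFieldAlong ψ Y q) q v =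
      fderiv ℝ (fieldInChart ψ Y (ψ q) ∘ (extChartAt (𝓡 n) x).symm) (extChartAt (𝓡 n) x q)
        (chartDeriv x q v) := by
    have : HasMFDerivAt (𝓡 n) 𝓘(ℝ, EuclideanSpace ℝ (Fin d)) (coordFieldAlong ψ Y q) q _ :=
      hasMFDerivAt_of_coord hq hY
    rw [this.mfderiv]
    rfl
  rw [← chartDeriv_mfderiv hq hp hψ, ← h1]
  exact (isInvertible_chartDeriv hp).self_apply_inverse _

/-- The covariant derivative along a map may be computed in any chart. -/
theorem chartDeriv_covDerivAlong (g : RiemMetric d M) {ψ : S → M}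
    {Y : ∀ q : S, TangentSpace (𝓡 d) (ψ q)} {x q : S} {c : M}
    (hq : q ∈ (extChartAt (𝓡 n) x).source) (hc : ψ q ∈ (extChartAt (𝓡 d) c).source)
    (hψ : ContMDiffAt (𝓡 n) (𝓡 d) 2 ψ q)
    (hg : IsMetricNear (coordMetric g c) (extChartAt (𝓡 d) c (ψ q)))
    (hY : DifferentiableAt ℝ (fieldInChart ψ Y (ψ q) ∘ (extChartAt (𝓡 n) x).symm)
      (extChartAt (𝓡 n) x q)) (v : TangentSpace (𝓡 n) q) :
    chartDeriv c (ψ q) (covDerivAlong g ψ Y q v) =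
      fderiv ℝ (fieldInChart ψ Y c ∘ (extChartAt (𝓡 n) x).symm) (extChartAt (𝓡 n) x q)
        (chartDeriv x q v) +
      christoffel (coordMetric g c) (extChartAt (𝓡 d) c (ψ q))
        (fderiv ℝ (mapInCharts ψ x c) (extChartAt (𝓡 n) x q) (chartDeriv x q v))
        (fieldInChart ψ Y c q) := by
  set p := ψ q with hpq
  set y := extChartAt (𝓡 n) x q with hy
  have hp : p ∈ (extChartAt (𝓡 d) p).source := mem_extChartAt_source p
  set τ := extChartAt (𝓡 d) c ∘ (extChartAt (𝓡 d) p).symm with hτdef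
  have hτ : ContDiffAt ℝ 2 τ (extChartAt (𝓡 d) p p) :=
    contDiffAt_coord (by norm_cast) hp (contMDiffAt_extChartAt_source hc (by norm_cast))
  have hnear : ∀ᶠ p' in 𝓝 p, p' ∈ (extChartAt (𝓡 d) p).source ∧
      p' ∈ (extChartAt (𝓡 d) c).source :=
    (eventually_mem_source_nhds hp).and (eventually_mem_source_nhds hc)
  have hτval : ∀ p' ∈ (extChartAt (𝓡 d) p).source,
      τ (extChartAt (𝓡 d) p p') = extChartAt (𝓡 d) c p' := fun p' h => by
    simp only [hτdef, Function.comp_apply, (extChartAt (𝓡 d) p).left_inv h]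
  have hpull : ∀ᶠ z in 𝓝 (extChartAt (𝓡 d) p p), ∀ u v, coordMetric g p z u v =
      coordMetric g c (τ z) (fderiv ℝ τ z u) (fderiv ℝ τ z v) := by
    refine eventually_extChartAt (hnear.mono ?_)
    rintro p' ⟨h1, h2⟩ u v
    obtain ⟨u, rfl⟩ := (isInvertible_chartDeriv h1).surjective u
    obtain ⟨v, rfl⟩ := (isInvertible_chartDeriv h1).surjective v
    rw [hτval p' h1, coordMetric_extChartAt g h1, ← chartDeriv_eq_fderiv h1 h2,
      ← chartDeriv_eq_fderiv h1 h2, coordMetric_extChartAt g h2]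
  have hgτ : IsMetricNear (coordMetric g c) (τ (extChartAt (𝓡 d) p p)) := by
    rwa [hτval p hp]
  have hΓ : ∀ u v, fderiv ℝ τ (extChartAt (𝓡 d) p p)
        (christoffel (coordMetric g p) (extChartAt (𝓡 d) p p) u v) =
      christoffel (coordMetric g c) (extChartAt (𝓡 d) c p)
        (fderiv ℝ τ (extChartAt (𝓡 d) p p) u) (fderiv ℝ τ (extChartAt (𝓡 d) p p) v) +
        fderiv ℝ (fderiv ℝ τ) (extChartAt (𝓡 d) p p) u v := fun u v => by
    refine eq_of_forall_pairing hgτ.pos.self_of_nhds fun w => ?_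
    obtain ⟨w, rfl⟩ := (isInvertible_chartDeriv hc).surjective w
    rw [chartDeriv_eq_fderiv hp hc, christoffel_pullback (isMetricNear_coordMetric g p) hgτ hτ
      hpull, hτval p hp]
  have hq' : Tendsto (fun z => ψ ((extChartAt (𝓡 n) x).symm z)) (𝓝 y) (𝓝 p) :=
    hψ.continuousAt.tendsto.comp (tendsto_extChartAt_symm hq)
  have hΨp : mapInCharts (n := n) (d := d) ψ x p y = extChartAt (𝓡 d) p p := by
    simp only [mapInCharts, Function.comp_apply, hy, (extChartAt (𝓡 n) x).left_inv hq, hpq]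
  have hmap : mapInCharts ψ x c =ᶠ[𝓝 y] τ ∘ mapInCharts ψ x p := by
    filter_upwards [hq'.eventually hnear] with z hz
    simp only [mapInCharts, Function.comp_apply, hτval _ hz.1]
  have hfield : fieldInChart ψ Y c ∘ (extChartAt (𝓡 n) x).symm =ᶠ[𝓝 y] fun z =>
      fderiv ℝ τ (mapInCharts ψ x p z)
        ((fieldInChart ψ Y p ∘ (extChartAt (𝓡 n) x).symm) z) := by
    filter_upwards [hq'.eventually hnear] with z hz
    exact chartDeriv_eq_fderiv hz.1 hz.2 _
  have hmd : HasFDerivAt (mapInCharts ψ x p) (fderiv ℝ (mapInCharts ψ x p) y) y :=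
    ((contDiffAt_mapInCharts hq hp hψ).differentiableAt (by norm_num)).hasFDerivAt
  have hτd : HasFDerivAt τ (fderiv ℝ τ (extChartAt (𝓡 d) p p)) (mapInCharts ψ x p y) := by
    rw [hΨp]
    exact (hτ.differentiableAt (by norm_num)).hasFDerivAt
  have hτd2 : HasFDerivAt (fderiv ℝ τ) (fderiv ℝ (fderiv ℝ τ) (extChartAt (𝓡 d) p p))
      (mapInCharts ψ x p y) := by
    rw [hΨp]
    exact ((hτ.fderiv_right (m := 1) (by norm_num)).differentiableAt (by norm_num)).hasFDerivAt
  have e1 : fderiv ℝ (mapInCharts ψ x c) y (chartDeriv x q v) =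
      fderiv ℝ τ (extChartAt (𝓡 d) p p) (fderiv ℝ (mapInCharts ψ x p) y (chartDeriv x q v)) := by
    rw [hmap.fderiv_eq, (hτd.comp y hmd).fderiv]
    rfl
  have e2 : fderiv ℝ (fieldInChart ψ Y c ∘ (extChartAt (𝓡 n) x).symm) y (chartDeriv x q v) =
      fderiv ℝ (fderiv ℝ τ) (extChartAt (𝓡 d) p p)
        (fderiv ℝ (mapInCharts ψ x p) y (chartDeriv x q v)) (fieldInChart ψ Y p q) +
      fderiv ℝ τ (extChartAt (𝓡 d) p p) (fderiv ℝ
        (fieldInChart ψ Y p ∘ (extChartAt (𝓡 n) x).symm) y (chartDeriv x q v)) := by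
    have hcomp : HasFDerivAt (fun z => fderiv ℝ τ (mapInCharts ψ x p z)) _ y :=
      hτd2.comp y hmd
    rw [hfield.fderiv_eq, (hcomp.clm_apply hY.hasFDerivAt).fderiv]
    simp only [add_apply, ContinuousLinearMap.comp_apply, ContinuousLinearMap.flip_apply,
      Function.comp_apply, hΨp]
    rw [add_comm, hy, (extChartAt (𝓡 n) x).left_inv hq]
  have e3 : fieldInChart ψ Y c q =
      fderiv ℝ τ (extChartAt (𝓡 d) p p) (fieldInChart ψ Y p q) :=
    chartDeriv_eq_fderiv hp hc (Y q)
  rw [chartDeriv_eq_fderiv hp hc, chartDeriv_covDerivAlong_self g hq hψ hY, map_add, e1, e2, e3,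
    hΓ]
  abel

end CovDeriv

/-! ### Tensor fields and hypersurfaces in charts -/

section EndInChart

variable {d : ℕ} {M : Type*} [TopologicalSpace M] [ChartedSpace (EuclideanSpace ℝ (Fin d)) M]
  {V : Type*} [NormedAddCommGroup V] [NormedSpace ℝ V]

/-- A field of endomorphisms, read in the preferred chart around `x`. -/
noncomputable def endInChart (T : ∀ q : M, TangentSpace (𝓡 d) q →ₗ[ℝ] TangentSpace (𝓡 d) q) (x : M)
    (y : EuclideanSpace ℝ (Fin d)) : EuclideanSpace ℝ (Fin d) →L[ℝ] EuclideanSpace ℝ (Fin d) :=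
  let q : M := (extChartAt (𝓡 d) x).symm y
  LinearMap.toContinuousLinearMap
    ((chartDeriv x q).toLinearMap ∘ₗ T q ∘ₗ (chartDeriv x q).inverse.toLinearMap)

variable [IsManifold (𝓡 d) ∞ M]

theorem endInChart_apply (T : ∀ q : M, TangentSpace (𝓡 d) q →ₗ[ℝ] TangentSpace (𝓡 d) q) {x q : M}
    (hq : q ∈ (extChartAt (𝓡 d) x).source) (w : TangentSpace (𝓡 d) q) :
    endInChart T x (extChartAt (𝓡 d) x q) (chartDeriv x q w) = chartDeriv x q (T q w) := by
  have h1 := isInvertible_chartDeriv hq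
  simp only [endInChart]
  rw [(extChartAt (𝓡 d) x).left_inv hq]
  simp [h1.inverse_apply_self]

theorem isInvertible_inner (g : RiemMetric d M) (q : M) : (g.inner q).IsInvertible :=
  isInvertible_of_pos (E := EuclideanSpace ℝ (Fin d)) (b := g.inner q) (g.pos q)

theorem inner_riemGradient (g : RiemMetric d M) (φ : M → ℝ) (q : M) (v : TangentSpace (𝓡 d) q) :
    g.inner q (riemGradient g φ q) v = mfderiv (𝓡 d) 𝓘(ℝ, ℝ) φ q v :=
  congrArg (fun L => L v) ((isInvertible_inner g q).self_apply_inverse _)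

/-- The gradient in a chart. -/
theorem coordMetric_riemGradient (g : RiemMetric d M) {φ : M → ℝ} {x q : M}
    (hq : q ∈ (extChartAt (𝓡 d) x).source)
    (hφ : DifferentiableAt ℝ (φ ∘ (extChartAt (𝓡 d) x).symm) (extChartAt (𝓡 d) x q)) :
    coordMetric g x (extChartAt (𝓡 d) x q) (chartDeriv x q (riemGradient g φ q)) =
      fderiv ℝ (φ ∘ (extChartAt (𝓡 d) x).symm) (extChartAt (𝓡 d) x q) := by
  ext v
  obtain ⟨v, rfl⟩ := (isInvertible_chartDeriv hq).surjective v
  rw [coordMetric_extChartAt g hq, inner_riemGradient, (hasMFDerivAt_of_coord hq hφ).mfderiv]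
  rfl

/-- The covariant derivative of a field of endomorphisms in a chart. -/
theorem chartDeriv_covDerivEnd (g : RiemMetric d M)
    (T : ∀ q : M, TangentSpace (𝓡 d) q →ₗ[ℝ] TangentSpace (𝓡 d) q) (x : M)
    (hT : DifferentiableAt ℝ (endInChart T x) (extChartAt (𝓡 d) x x))
    (v w : TangentSpace (𝓡 d) x) :
    chartDeriv x x (covDerivEnd g T x v w) =
      coordCovDerivEnd (coordMetric g x) (endInChart T x) (extChartAt (𝓡 d) x x)
        (chartDeriv x x v) (chartDeriv x x w) := by
  have hx := mem_extChartAt_source (I := 𝓡 d) x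
  have hid : ContMDiffAt (𝓡 d) (𝓡 d) 2 (fun q : M => q) x := contMDiffAt_id
  have hmap : mapInCharts (fun q : M => q) x x =ᶠ[𝓝 (extChartAt (𝓡 d) x x)] id := by
    filter_upwards [extChartAt_target_mem_nhds (I := 𝓡 d) x] with y hy
    simp only [mapInCharts, Function.comp_apply, (extChartAt (𝓡 d) x).right_inv hy, id]
  have hT' : fieldInChart (fun q : M => q) (fun q => T q (constExtension x w q)) x ∘
      (extChartAt (𝓡 d) x).symm =ᶠ[𝓝 (extChartAt (𝓡 d) x x)]
        fun y => endInChart T x y (chartDeriv x x w) :=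
    .of_forall fun y => rfl
  have hW : fieldInChart (fun q : M => q) (constExtension x w) x ∘
      (extChartAt (𝓡 d) x).symm =ᶠ[𝓝 (extChartAt (𝓡 d) x x)] fun _ => chartDeriv x x w := by
    refine eventually_extChartAt ?_
    filter_upwards [eventually_mem_source (d := d) x] with q hq
    simp only [Function.comp_apply, (extChartAt (𝓡 d) x).left_inv hq]
    exact (isInvertible_chartDeriv hq).self_apply_inverse _
  have hTd := hT.hasFDerivAt.clm_apply
    (hasFDerivAt_const (chartDeriv x x w) (extChartAt (𝓡 d) x x))
  have h1 := chartDeriv_covDerivAlong_self g (Y := fun q => T q (constExtension x w q)) hx hid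
    (hTd.differentiableAt.congr_of_eventuallyEq hT') v
  have h2 := chartDeriv_covDerivAlong_self g (Y := constExtension x w) hx hid
    ((differentiableAt_const _).congr_of_eventuallyEq hW) v
  have hWx : constExtension x w x = w := (isInvertible_chartDeriv hx).inverse_apply_self w
  rw [hT'.fderiv_eq, hmap.fderiv_eq, hTd.fderiv] at h1
  rw [hW.fderiv_eq, hmap.fderiv_eq] at h2
  simp only [fieldInChart, hWx, fderiv_id, fderiv_fun_const] at h1 h2
  rw [covDerivEnd, map_sub, ← endInChart_apply T hx, covDeriv, covDeriv, h1, h2,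
    ← endInChart_apply T hx, coordCovDerivEnd]
  simp

theorem chartDeriv_weightedDivergence (g : RiemMetric d M) (φ : M → ℝ)
    (T : ∀ q : M, TangentSpace (𝓡 d) q →ₗ[ℝ] TangentSpace (𝓡 d) q) (x : M)
    (hφ : DifferentiableAt ℝ (φ ∘ (extChartAt (𝓡 d) x).symm) (extChartAt (𝓡 d) x x))
    (hT : DifferentiableAt ℝ (endInChart T x) (extChartAt (𝓡 d) x x))
    (e : Fin d → TangentSpace (𝓡 d) x) :
    chartDeriv x x (weightedDivergence g φ T x e) =
      coordWeightedDivergence (coordMetric g x) (φ ∘ (extChartAt (𝓡 d) x).symm)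
        (endInChart T x) (extChartAt (𝓡 d) x x) (fun i => chartDeriv x x (e i)) := by
  have h1 : endInChart (fun q => Real.exp (-φ q) • T q) x = fun y =>
      Real.exp (-(φ ∘ (extChartAt (𝓡 d) x).symm) y) • endInChart T x y := by
    ext1 y
    ext1 v
    let q : M := (extChartAt (𝓡 d) x).symm y
    exact map_smul (chartDeriv x q) (Real.exp (-φ q)) (T q ((chartDeriv x q).inverse v))
  have h2 : DifferentiableAt ℝ (endInChart (fun q => Real.exp (-φ q) • T q) x)
      (extChartAt (𝓡 d) x x) := by
    rw [h1]
    exact hφ.fun_neg.exp.fun_smul hT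
  rw [weightedDivergence, coordWeightedDivergence, coordDivergence, divergence, map_smul, map_sum,
    ← h1]
  simp only [chartDeriv_covDerivEnd g _ x h2, Function.comp_apply,
    (extChartAt (𝓡 d) x).left_inv (mem_extChartAt_source x)]

theorem chartDeriv_curvature (g : RiemMetric d M) (x : M) (u v w : TangentSpace (𝓡 d) x) :
    chartDeriv x x (curvature g x u v w) =
      coordCurvature (coordMetric g x) (extChartAt (𝓡 d) x x)
        (chartDeriv x x u) (chartDeriv x x v) (chartDeriv x x w) :=
  (isInvertible_chartDeriv (mem_extChartAt_source x)).self_apply_inverse _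

end EndInChart

section Hypersurface

variable {n : ℕ} {M : Type*} [TopologicalSpace M] [ChartedSpace (EuclideanSpace ℝ (Fin n)) M]
  [IsManifold (𝓡 n) ∞ M]

/-- The weighted Newton transformations in a chart. -/
theorem endInChart_weightedNewton (μ : M → ℝ)
    (A : ∀ q : M, TangentSpace (𝓡 n) q →ₗ[ℝ] TangentSpace (𝓡 n) q) {x q : M}
    (hq : q ∈ (extChartAt (𝓡 n) x).source) (k : ℕ) :
    endInChart (fun q => weightedNewton (μ q) (A q) k) x (extChartAt (𝓡 n) x q) =
      newtonTransform (fun j => weightedSigmaOp (μ q) (A q) j)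
        (endInChart A x (extChartAt (𝓡 n) x q)) k := by
  induction k with
  | zero =>
    ext1 v
    obtain ⟨v, rfl⟩ := (isInvertible_chartDeriv hq).surjective v
    rw [endInChart_apply _ hq]
    rfl
  | succ k ih =>
    ext1 v
    obtain ⟨v, rfl⟩ := (isInvertible_chartDeriv hq).surjective v
    rw [endInChart_apply _ hq, newtonTransform, ← ih, sub_apply, smul_apply, mul_apply_eq_comp,
      endInChart_apply _ hq, endInChart_apply _ hq, one_apply_eq_self, ← map_smul, ← map_sub]
    rfl

theorem clmTrace_endInChart_pow
    (A : ∀ q : M, TangentSpace (𝓡 n) q →ₗ[ℝ] TangentSpace (𝓡 n) q) {x q : M}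
    (hq : q ∈ (extChartAt (𝓡 n) x).source) (j : ℕ) :
    clmTrace (EuclideanSpace ℝ (Fin n)) (endInChart A x (extChartAt (𝓡 n) x q) ^ j) =
      LinearMap.trace ℝ (TangentSpace (𝓡 n) q) (A q ^ j) := by
  obtain ⟨L, hL⟩ := isInvertible_chartDeriv hq
  have hL' : ∀ w, L w = chartDeriv x q w := fun w => by rw [← hL]; rfl
  have h1 : ∀ w, (endInChart A x (extChartAt (𝓡 n) x q) ^ j) (L w) = L ((A q ^ j) w) := by
    induction j with
    | zero => intro w; rfl
    | succ j ih =>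
      intro w
      rw [pow_succ', pow_succ', mul_apply_eq_comp, ih, hL', endInChart_apply A hq, hL']
      rfl
  rw [clmTrace_apply, ← LinearMap.trace_conj' (A q ^ j) L.toLinearEquiv]
  congr 1
  ext1 v
  obtain ⟨w, rfl⟩ := L.surjective v
  rw [LinearEquiv.conj_apply_apply]
  refine (h1 w).trans ?_
  exact congrArg (fun z => L ((A q ^ j) z)) (L.symm_apply_apply w).symm

theorem isNewtonSequence_weightedSigmaOp (g : RiemMetric n M) (μ : M → ℝ)
    (A : ∀ q : M, TangentSpace (𝓡 n) q →ₗ[ℝ] TangentSpace (𝓡 n) q) {x : M}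
    (hA : ∀ᶠ q in 𝓝 x, ∀ v w, g.inner q (A q v) w = g.inner q v (A q w)) :
    IsNewtonSequence (μ ∘ (extChartAt (𝓡 n) x).symm) (endInChart A x)
      (fun k => (fun q => weightedSigmaOp (μ q) (A q) k) ∘ (extChartAt (𝓡 n) x).symm)
      (extChartAt (𝓡 n) x x) := by
  refine ⟨.of_forall fun z => weightedSigma_zero _ _, eventually_extChartAt ?_⟩
  filter_upwards [eventually_mem_source (d := n) x, hA] with q hq hAq k
  have hsum := sum_pow_eigenvalueMultiset (V := TangentSpace (𝓡 n) q)
    (ContinuousLinearMap.coeLM ℝ ∘ₗ (g.inner q).toLinearMap) (g.symm q) (g.pos q) (A q) hAq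
  have hσ : ∀ j, ((fun q => weightedSigmaOp (μ q) (A q) j) ∘ (extChartAt (𝓡 n) x).symm)
      (extChartAt (𝓡 n) x q) = weightedSigmaOp (μ q) (A q) j :=
    fun j => comp_extChartAt_symm_apply _ hq
  simp only [hσ, comp_extChartAt_symm_apply μ hq, clmTrace_endInChart_pow A hq, ← hsum]
  exact weightedSigma_succ _ _ k

variable {P : Type*} [TopologicalSpace P] [ChartedSpace (EuclideanSpace ℝ (Fin (n + 1))) P]
  [IsManifold (𝓡 (n + 1)) ∞ P] {g : RiemMetric n M} {gP : RiemMetric (n + 1) P} {ψ : M → P}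
  {N : ∀ q : M, TangentSpace (𝓡 (n + 1)) (ψ q)}

theorem inner_tangentialPart (g : RiemMetric n M) (gP : RiemMetric (n + 1) P) (ψ : M → P) (q : M)
    (w : TangentSpace (𝓡 (n + 1)) (ψ q)) (v : TangentSpace (𝓡 n) q) :
    g.inner q (tangentialPart g gP ψ q w) v =
      gP.inner (ψ q) w (mfderiv (𝓡 n) (𝓡 (n + 1)) ψ q v) :=
  congrArg (fun L => L v) ((isInvertible_inner g q).self_apply_inverse _)

omit [IsManifold (𝓡 n) ∞ M] in
theorem contMDiffAt_fieldInChart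
    (hN : ContMDiff (𝓡 n) (𝓡 (n + 1)).tangent ∞
      (fun q => (⟨ψ q, N q⟩ : TangentBundle (𝓡 (n + 1)) P))) (q : M) :
    ContMDiffAt (𝓡 n) 𝓘(ℝ, EuclideanSpace ℝ (Fin (n + 1))) 2 (fieldInChart ψ N (ψ q)) q := by
  obtain ⟨h1, h2⟩ := Bundle.contMDiffAt_totalSpace.1 (hN q)
  refine (ContMDiffAt.of_le h2 (by norm_cast)).congr_of_eventuallyEq ?_
  filter_upwards [h1.continuousAt.eventually (eventually_mem_source (d := n + 1) (ψ q))] with q' hq'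
  exact (trivializationAt_snd_eq_chartDeriv (⟨ψ q', N q'⟩ : TangentBundle (𝓡 (n + 1)) P) hq').symm

theorem isHypersurfaceNear (hψ : IsIsometricImmersion g gP ψ)
    (hN : IsUnitNormalField (n := n) gP ψ N) (x : M) :
    IsHypersurfaceNear (coordMetric g x) (coordMetric gP (ψ x)) (mapInCharts ψ x (ψ x))
      (fieldInChart ψ N (ψ x) ∘ (extChartAt (𝓡 n) x).symm)
      (endInChart (shapeOperator g gP ψ N) x) (extChartAt (𝓡 n) x x) := by
  have hx := mem_extChartAt_source (I := 𝓡 n) x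
  have hψx := mem_extChartAt_source (I := 𝓡 (n + 1)) (ψ x)
  have hψ2 : ContMDiff (𝓡 n) (𝓡 (n + 1)) 2 ψ := hψ.1.of_le (by norm_cast)
  have hmap : ∀ q ∈ (extChartAt (𝓡 n) x).source,
      mapInCharts ψ x (ψ x) (extChartAt (𝓡 n) x q) = extChartAt (𝓡 (n + 1)) (ψ x) (ψ q) :=
    fun q hq => comp_extChartAt_symm_apply (extChartAt (𝓡 (n + 1)) (ψ x) ∘ ψ) hq
  have hfield : ∀ q ∈ (extChartAt (𝓡 n) x).source,
      (fieldInChart ψ N (ψ x) ∘ (extChartAt (𝓡 n) x).symm) (extChartAt (𝓡 n) x q) =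
        chartDeriv (ψ x) (ψ q) (N q) := fun q hq =>
    comp_extChartAt_symm_apply (fieldInChart ψ N (ψ x)) hq
  have hnear : ∀ᶠ q in 𝓝 x, q ∈ (extChartAt (𝓡 n) x).source ∧
      ψ q ∈ (extChartAt (𝓡 (n + 1)) (ψ x)).source ∧
      IsMetricNear (coordMetric gP (ψ x)) (extChartAt (𝓡 (n + 1)) (ψ x) (ψ q)) :=
    (eventually_mem_source x).and (((hψ2 x).continuousAt.eventually
      (eventually_mem_source (ψ x))).and ((hψ2 x).continuousAt.eventually
        ((continuousAt_extChartAt (ψ x)).eventually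
          (isMetricNear_coordMetric gP (ψ x)).eventually_nhds)))
  refine
    { metric := isMetricNear_coordMetric g x
      ambient := by
        rw [hmap x hx]
        exact isMetricNear_coordMetric gP (ψ x)
      contDiffAt := contDiffAt_mapInCharts hx hψx (hψ2 x)
      contDiffAt_normal := contDiffAt_coord (by norm_cast) hx (contMDiffAt_fieldInChart hN.1 x)
      pullback := eventually_extChartAt (hnear.mono ?_)
      unit := eventually_extChartAt (hnear.mono ?_)
      normal := eventually_extChartAt (hnear.mono ?_)
      shape := eventually_extChartAt (hnear.mono ?_)
      finrank := by simp }
  · rintro q ⟨hq, hq', -⟩ u v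
    obtain ⟨u, rfl⟩ := (isInvertible_chartDeriv hq).surjective u
    obtain ⟨v, rfl⟩ := (isInvertible_chartDeriv hq).surjective v
    rw [hmap q hq, coordMetric_extChartAt g hq, ← chartDeriv_mfderiv hq hq' (hψ2 q),
      ← chartDeriv_mfderiv hq hq' (hψ2 q), coordMetric_extChartAt gP hq', hψ.2]
  · rintro q ⟨hq, hq', -⟩
    rw [hmap q hq, hfield q hq, coordMetric_extChartAt gP hq', (hN.2 q).1]
  · rintro q ⟨hq, hq', -⟩ u
    obtain ⟨u, rfl⟩ := (isInvertible_chartDeriv hq).surjective u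
    rw [hmap q hq, hfield q hq, ← chartDeriv_mfderiv hq hq' (hψ2 q),
      coordMetric_extChartAt gP hq', (hN.2 q).2]
  · rintro q ⟨hq, hq', hmet⟩ u w
    obtain ⟨u, rfl⟩ := (isInvertible_chartDeriv hq).surjective u
    obtain ⟨w, rfl⟩ := (isInvertible_chartDeriv hq).surjective w
    have hd := (contDiffAt_coord (n := 2) (by norm_cast) hq
      (contMDiffAt_fieldInChart hN.1 q)).differentiableAt (by norm_num)
    have hcov := chartDeriv_covDerivAlong gP hq hq' (hψ2 q) hmet hd u
    rw [hmap q hq, hfield q hq, endInChart_apply _ hq, coordMetric_extChartAt g hq]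
    rw [fieldInChart] at hcov
    rw [← hcov, ← chartDeriv_mfderiv hq hq' (hψ2 q), coordMetric_extChartAt gP hq',
      ← inner_tangentialPart g gP ψ q]
    simp [shapeOperator]

theorem inner_shapeOperator (hψ : IsIsometricImmersion g gP ψ)
    (hN : IsUnitNormalField (n := n) gP ψ N) (q : M) (v w : TangentSpace (𝓡 n) q) :
    g.inner q (shapeOperator g gP ψ N q v) w = g.inner q v (shapeOperator g gP ψ N q w) := by
  have hq := mem_extChartAt_source (I := 𝓡 n) q
  have h1 := (isHypersurfaceNear hψ hN q).shape_symm (chartDeriv q q v) (chartDeriv q q w)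
  rwa [endInChart_apply _ hq, endInChart_apply _ hq, coordMetric_extChartAt g hq,
    coordMetric_extChartAt g hq] at h1

theorem differentiableAt_normalDerivative (hψ : ContMDiff (𝓡 n) (𝓡 (n + 1)) ∞ ψ)
    (hN : ContMDiff (𝓡 n) (𝓡 (n + 1)).tangent ∞
      (fun q => (⟨ψ q, N q⟩ : TangentBundle (𝓡 (n + 1)) P)))
    {f : P → ℝ} (hf : ContMDiff (𝓡 (n + 1)) 𝓘(ℝ, ℝ) ∞ f) (x : M) :
    DifferentiableAt ℝ (normalDerivative gP ψ N f ∘ (extChartAt (𝓡 n) x).symm)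
      (extChartAt (𝓡 n) x x) := by
  have hx := mem_extChartAt_source (I := 𝓡 n) x
  have hψx := mem_extChartAt_source (I := 𝓡 (n + 1)) (ψ x)
  have hψ2 : ContMDiffAt (𝓡 n) (𝓡 (n + 1)) 2 ψ x := (hψ x).of_le (by norm_cast)
  have hf2 : ContMDiff (𝓡 (n + 1)) 𝓘(ℝ, ℝ) 2 f := hf.of_le (by norm_cast)
  have hmapx : mapInCharts ψ x (ψ x) (extChartAt (𝓡 n) x x) =
      extChartAt (𝓡 (n + 1)) (ψ x) (ψ x) :=
    comp_extChartAt_symm_apply (extChartAt (𝓡 (n + 1)) (ψ x) ∘ ψ) hx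
  have h1 : DifferentiableAt ℝ (fderiv ℝ (f ∘ (extChartAt (𝓡 (n + 1)) (ψ x)).symm))
      (mapInCharts ψ x (ψ x) (extChartAt (𝓡 n) x x)) := by
    rw [hmapx]
    exact ((contDiffAt_coord (by norm_cast) hψx (hf2 _)).fderiv_right
      (m := 1) (by norm_num)).differentiableAt (by norm_num)
  have h2 := (contDiffAt_mapInCharts hx hψx hψ2).differentiableAt (by norm_num)
  have h3 := (contDiffAt_coord (by norm_cast) hx
    (contMDiffAt_fieldInChart hN x)).differentiableAt (by norm_num)
  refine ((h1.comp _ h2).clm_apply h3).congr_of_eventuallyEq (eventually_extChartAt ?_)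
  filter_upwards [eventually_mem_source (d := n) x,
    hψ2.continuousAt.eventually (eventually_mem_source (d := n + 1) (ψ x))] with q hq hq'
  have h4 := hasMFDerivAt_of_coord hq' ((contDiffAt_coord (by norm_cast) hq'
    (hf2 _)).differentiableAt (by norm_num))
  rw [comp_extChartAt_symm_apply _ hq, comp_extChartAt_symm_apply _ hq, Function.comp_apply,
    mapInCharts, comp_extChartAt_symm_apply _ hq, normalDerivative, inner_riemGradient, h4.mfderiv]
  rfl

end Hypersurface

theorem Filter.EventuallyEq.coordWeightedDivergence_eq {E : Type*} [NormedAddCommGroup E]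
    [NormedSpace ℝ E] {ι : Type*} [Fintype ι] (h : E → E →L[ℝ] E →L[ℝ] ℝ) (φ : E → ℝ)
    {t t' : E → E →L[ℝ] E} {y : E} (ht : t =ᶠ[𝓝 y] t') (e : ι → E) :
    coordWeightedDivergence h φ t y e = coordWeightedDivergence h φ t' y e := by
  have h1 : (fun z => Real.exp (-φ z) • t z) =ᶠ[𝓝 y] fun z => Real.exp (-φ z) • t' z :=
    ht.mono fun z hz => by simp only [hz]
  simp only [coordWeightedDivergence, coordDivergence, coordCovDerivEnd, h1.fderiv_eq,
    h1.self_of_nhds]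

theorem mainTheorem3 {n : ℕ}
    {M : Type*} [TopologicalSpace M] [ChartedSpace (EuclideanSpace ℝ (Fin n)) M]
    [IsManifold (𝓡 n) ∞ M]
    {P : Type*} [TopologicalSpace P] [ChartedSpace (EuclideanSpace ℝ (Fin (n + 1))) P]
    [IsManifold (𝓡 (n + 1)) ∞ P]
    (g : RiemMetric n M) (gP : RiemMetric (n + 1) P)
    (ψ : M → P) (hψ : IsIsometricImmersion g gP ψ)
    (N : ∀ q : M, TangentSpace (𝓡 (n + 1)) (ψ q)) (hN : IsUnitNormalField (n := n) gP ψ N)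
    (f : P → ℝ) (hf : ContMDiff (𝓡 (n + 1)) 𝓘(ℝ, ℝ) ∞ f)
    (A : ∀ q : M, TangentSpace (𝓡 n) q →ₗ[ℝ] TangentSpace (𝓡 n) q)
    (hA : A = shapeOperator g gP ψ N)
    (μ : M → ℝ) (hμ : μ = normalDerivative gP ψ N f)
    (σ : ℕ → M → ℝ) (hσ : σ = fun k q => weightedSigmaOp (μ q) (A q) k)
    (T : ℕ → ∀ q : M, TangentSpace (𝓡 n) q →ₗ[ℝ] TangentSpace (𝓡 n) q)
    (hT : T = fun k q => weightedNewton (μ q) (A q) k)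
    (x : M) (e : Fin n → TangentSpace (𝓡 n) x) (he : IsOrthonormalBasis g x e) :
    weightedDivergence g (f ∘ ψ) (T 0) x e = -riemGradient g (f ∘ ψ) x ∧
    ∀ k : ℕ, 1 ≤ k →
      weightedDivergence g (f ∘ ψ) (T k) x e =
        -(σ k x • riemGradient g (f ∘ ψ) x) + σ (k - 1) x • riemGradient g μ x
          - A x (weightedDivergence g (f ∘ ψ) (T (k - 1)) x e)
          - ∑ i, tangentialPart g gP ψ x
              (curvature gP (ψ x) (N x) (mfderiv (𝓡 n) (𝓡 (n + 1)) ψ x (T (k - 1) x (e i)))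
                (mfderiv (𝓡 n) (𝓡 (n + 1)) ψ x (e i))) := by

  subst hA hμ hσ hT
  set A := shapeOperator g gP ψ N
  set μ := normalDerivative gP ψ N f
  set y := extChartAt (𝓡 n) x x
  set φ := (f ∘ ψ) ∘ (extChartAt (𝓡 n) x).symm
  set e' : Fin n → EuclideanSpace ℝ (Fin n) := fun i => chartDeriv x x (e i)
  set s : ℕ → EuclideanSpace ℝ (Fin n) → ℝ := fun k =>
    (fun q => weightedSigmaOp (μ q) (A q) k) ∘ (extChartAt (𝓡 n) x).symm
  have hx := mem_extChartAt_source (I := 𝓡 n) x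
  have hψx := mem_extChartAt_source (I := 𝓡 (n + 1)) (ψ x)
  have hψ2 : ContMDiffAt (𝓡 n) (𝓡 (n + 1)) 2 ψ x := (hψ.1 x).of_le (by norm_cast)
  have hS := isHypersurfaceNear hψ hN x
  have hC := isInvertible_chartDeriv hx
  have he' : ∀ i j, coordMetric g x y (e' i) (e' j) = if i = j then 1 else 0 := fun i j => by
    rw [coordMetric_extChartAt g hx, he]
  have hcard : Fintype.card (Fin n) = Module.finrank ℝ (EuclideanSpace ℝ (Fin n)) := by simp
  have hφ : DifferentiableAt ℝ φ y :=
    (contDiffAt_coord (n := 1) (by norm_cast) hx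
      (((hf.of_le (by norm_cast)).contMDiffAt).comp x
        ((hψ.1 x).of_le (by norm_cast)))).differentiableAt (by norm_num)
  have hm : DifferentiableAt ℝ (μ ∘ (extChartAt (𝓡 n) x).symm) y :=
    differentiableAt_normalDerivative hψ.1 hN.1 hf x
  have hnewton : IsNewtonSequence (μ ∘ (extChartAt (𝓡 n) x).symm) (endInChart A x) s y :=
    isNewtonSequence_weightedSigmaOp g μ A (.of_forall fun q => inner_shapeOperator hψ hN q)
  have hsx : ∀ k, s k y = weightedSigmaOp (μ x) (A x) k := fun k =>
    comp_extChartAt_symm_apply _ hx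
  have ht : ∀ k, endInChart (fun q => weightedNewton (μ q) (A q) k) x =ᶠ[𝓝 y]
      fun z => newtonTransform (fun j => s j z) (endInChart A x z) k := fun k => by
    refine eventually_extChartAt ?_
    filter_upwards [eventually_mem_source (d := n) x] with q hq
    have hsq : ∀ j, s j (extChartAt (𝓡 n) x q) = weightedSigmaOp (μ q) (A q) j := fun j =>
      comp_extChartAt_symm_apply _ hq
    rw [endInChart_weightedNewton μ A hq]
    simp only [hsq]
  have htd : ∀ k, DifferentiableAt ℝ (endInChart (fun q => weightedNewton (μ q) (A q) k) x) y :=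
    fun k => (hnewton.differentiableAt_newtonTransform hm hS.differentiableAt_shape
      k).congr_of_eventuallyEq (ht k)
  have hdiv : ∀ k, chartDeriv x x (weightedDivergence g (f ∘ ψ)
      (fun q => weightedNewton (μ q) (A q) k) x e) = coordWeightedDivergence (coordMetric g x) φ
        (fun z => newtonTransform (fun j => s j z) (endInChart A x z) k) y e' := fun k => by
    rw [chartDeriv_weightedDivergence g (f ∘ ψ) _ x hφ (htd k) e,
      (ht k).coordWeightedDivergence_eq]
  have hG := coordMetric_riemGradient g hx hφ
  have hGm := coordMetric_riemGradient g hx hm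
  have hmapx : mapInCharts ψ x (ψ x) y = extChartAt (𝓡 (n + 1)) (ψ x) (ψ x) :=
    comp_extChartAt_symm_apply (extChartAt (𝓡 (n + 1)) (ψ x) ∘ ψ) hx
  have hfieldx : (fieldInChart ψ N (ψ x) ∘ (extChartAt (𝓡 n) x).symm) y =
      chartDeriv (ψ x) (ψ x) (N x) := comp_extChartAt_symm_apply (fieldInChart ψ N (ψ x)) hx
  refine ⟨hC.injective ?_, fun k hk => ?_⟩
  · rw [hdiv 0, map_neg]
    exact IsHypersurfaceNear.coordWeightedDivergence_zero he' hcard hφ hG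
  · obtain ⟨k, rfl⟩ := Nat.exists_eq_succ_of_ne_zero (Nat.one_le_iff_ne_zero.1 hk)
    rw [Nat.succ_eq_add_one, Nat.add_sub_cancel]
    apply hC.injective
    have hX : ∀ i w, coordMetric g x y (chartDeriv x x (tangentialPart g gP ψ x
        (curvature gP (ψ x) (N x) (mfderiv (𝓡 n) (𝓡 (n + 1)) ψ x
          (weightedNewton (μ x) (A x) k (e i))) (mfderiv (𝓡 n) (𝓡 (n + 1)) ψ x (e i))))) w =
        coordMetric gP (ψ x) (mapInCharts ψ x (ψ x) y) (coordCurvature (coordMetric gP (ψ x))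
          (mapInCharts ψ x (ψ x) y) ((fieldInChart ψ N (ψ x) ∘ (extChartAt (𝓡 n) x).symm) y)
          (fderiv ℝ (mapInCharts ψ x (ψ x)) y
            (newtonTransform (fun j => s j y) (endInChart A x y) k (e' i)))
          (fderiv ℝ (mapInCharts ψ x (ψ x)) y (e' i)))
          (fderiv ℝ (mapInCharts ψ x (ψ x)) y w) := fun i w => by
      obtain ⟨w, rfl⟩ := hC.surjective w
      have h1 := (ht k).self_of_nhds
      simp only at h1
      rw [coordMetric_extChartAt g hx, inner_tangentialPart, ← h1, endInChart_apply _ hx, hmapx,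
        hfieldx, ← chartDeriv_mfderiv hx hψx hψ2, ← chartDeriv_mfderiv hx hψx hψ2,
        ← chartDeriv_mfderiv hx hψx hψ2, ← chartDeriv_curvature, coordMetric_extChartAt gP hψx]
    rw [hdiv, hS.coordWeightedDivergence_succ he' hcard hφ hm hnewton k hG hGm hX, ← hdiv,
      endInChart_apply _ hx, hsx, hsx]
    simp only [map_sub, map_add, map_neg, map_smul, map_sum]
    rfl
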